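/- Let $d\ge 0$ and let $\zeta=(\zeta(t))_{t\ge0}$ be a càdlàg (time-homogeneous) Markov process with values in $\mathbb R^d$, with laws $\mathbb P_x$, $x\in\mathbb R^d$, on the space of càdlàg paths: $\mathbb P_x$ is the law of $\zeta$ given $\zeta(0)=x$, it depends measurably on $x$, and there is a transition function (semigroup of Markov kernels) $(R_t)_{t\ge0}$ on $\mathbb R^d$ such that for all $x,s,t$, under $\mathbb P_x$, the conditional law of $\zeta(s+t)$ given $\sigma(\zeta(u),u\le s)$ is $R_t(\zeta(s),\cdot)$. Let $\lambda:\mathbb R^d\to\mathbb R_+$ be measurable and let $Q$ be a Markov kernel on $\mathbb R^d$. Assume that for every $x$, $\mathbb P_x$-almost surely, there is $\varepsilon>0$ with $\int_0^\varepsilon\lambda(\zeta(v))\,dv<\infty$, and $\int_0^{\infty}\lambda(\zeta(v))\,dv=\infty$. Put $$M(\zeta;dy,dv)=\lambda(\zeta(v))\,e^{-\int_0^v\lambda(\zeta(w))\,dw}\,Q(\zeta(v);dy)\,dv\quad\text{on }\mathbb R^d\times\mathbb R_+ .$$ A switching process associated with $\zeta$ and $M$, with initial state $x_0\in\mathbb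 R^d$, is a process $X=(X_t)_{t\ge0}$ on a probability space on which there are càdlàg processes $\zeta^{(1)},\zeta^{(2)},\dots$, $\mathbb R^d$-valued variables $Y_0=x_0,Y_1,Y_2,\dots$ and times $0=T_0\le T_1\le T_2\le\cdots$ such that for all $n\ge0$: (a) the conditional law of $\zeta^{(n+1)}$ given $\zeta^{(1)},\dots,\zeta^{(n)},Y_1,T_1,\dots,Y_n,T_n$ is $\mathbb P_{Y_n}$; (b) the conditional law of $(Y_{n+1},T_{n+1}-T_n)$ given $\zeta^{(1)},\dots,\zeta^{(n+1)},Y_1,T_1,\dots,Y_n,T_n$ is $M(\zeta^{(n+1)};\cdot)$; (c) almost surely, $X_t=\zeta^{(n+1)}(t-T_n)$ for $T_n\le t<T_{n+1}$, and $X_{T_n}=Y_n$; and such that $T_n\to\infty$ almost surely. Then every switching process associated with $\zeta$ and $M$ is a Markov process. More precisely, there is a transition function $(P_t)_{t\ge0}$ on $\mathbb R^d$ such that for every $x_0\in\mathbb R^d$, every switching process $X$ associated with $\zeta$ and $M$ with initial state $x_0$ and all $s,t\ge0$, the conditional law of $X_{s+t}$ given $\sigma(X_u,u\le s)$ is $P_t(X_s,\cdot)$.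 -/

import Mathlib

open MeasureTheory ProbabilityTheory Filter Topology
open scoped NNReal ENNReal

noncomputable section

namespace Switching

/-! ### Càdlàg paths -/

/-- A path indexed by `ℝ₊` is càdlàg: right-continuous, with left limits at every `t > 0`. -/
def IsCadlag {E : Type*} [TopologicalSpace E] (f : ℝ≥0 → E) : Prop :=
  ∀ t : ℝ≥0, ContinuousWithinAt f (Set.Ici t) t ∧ (0 < t → ∃ l : E, Tendsto f (𝓝[<] t) (𝓝 l))

/-- The space of càdlàg paths with values in `E`, with the σ-algebra generated by the evaluations
`ζ ↦ ζ(t)`, `t ≥ 0` (the one induced by the product σ-algebra on `ℝ≥0 → E`). -/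
abbrev CadlagPath (E : Type*) [TopologicalSpace E] : Type _ := {f : ℝ≥0 → E // IsCadlag f}

/-! ### Conditional laws and Markov processes -/

/-- Under `μ`, the random measure `κ` is a (regular) conditional law of `Z` given the
σ-algebra `m`: for each measurable `B`, the variable `κ(B)` is `m`-measurable and is a version of
the conditional probability `μ(Z ∈ B | m)`. -/
structure HasCondLaw {Ω F : Type*} [MeasurableSpace F] {mΩ : MeasurableSpace Ω}
    (μ : Measure Ω) (m : MeasurableSpace Ω) (Z : Ω → F) (κ : Ω → Measure F) : Prop where
  measurable : ∀ B : Set F, MeasurableSet B → Measurable[m] (fun ω => κ ω B)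
  setLIntegral_eq : ∀ A : Set Ω, MeasurableSet[m] A → ∀ B : Set F, MeasurableSet B →
    μ (A ∩ Z ⁻¹' B) = ∫⁻ ω in A, κ ω B ∂μ

/-- The σ-algebra of the past at time `s`, generated by the variables `X u`, `u ≤ s`. -/
abbrev past {Ω E : Type*} [MeasurableSpace E] (X : ℝ≥0 → Ω → E) (s : ℝ≥0) : MeasurableSpace Ω :=
  ⨆ u : ℝ≥0, ⨆ _ : u ≤ s, MeasurableSpace.comap (X u) inferInstance

/-- A (time-homogeneous) transition function on `E`: a semigroup of Markov kernels. -/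
structure IsTransitionFunction {E : Type*} [MeasurableSpace E] (P : ℝ≥0 → Kernel E E) :
    Prop where
  isMarkovKernel : ∀ t, IsMarkovKernel (P t)
  zero : P 0 = Kernel.id
  add : ∀ s t, P (s + t) = P t ∘ₖ P s

/-- Under `μ`, the process `X` is a Markov process (for its own past) with transition function
`P`: the conditional law of `X (s + t)` given the past at time `s` is `P t (X s)`. -/
structure IsMarkovProcess {Ω E : Type*} [MeasurableSpace E] {mΩ : MeasurableSpace Ω}
    (P : ℝ≥0 → Kernel E E) (μ : Measure Ω) (X : ℝ≥0 → Ω → E) : Prop where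
  measurable : ∀ t, Measurable (X t)
  condLaw : ∀ s t, HasCondLaw μ (past X s) (X (s + t)) (fun ω => P t (X s ω))

/-- The laws `law x` of a càdlàg process `ζ` given `ζ(0) = x`, for `x` in `E`, are those of a Markov
process: they are probabilities depending measurably on `x`, `ζ(0) = x` almost surely under `law x`,
and there is one transition function for which `ζ` is a Markov process under every `law x`. -/
structure IsMarkovFamily {E : Type*} [TopologicalSpace E] [MeasurableSpace E]
    (law : Kernel E (CadlagPath E)) : Prop where
  isMarkovKernel : IsMarkovKernel law
  start : ∀ x, ∀ᵐ ζ ∂(law x), ζ.1 0 = x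
  markov : ∃ R : ℝ≥0 → Kernel E E, IsTransitionFunction R ∧
    ∀ x, IsMarkovProcess R (law x) (fun t (ζ : CadlagPath E) => ζ.1 t)

/-! ### The jump mechanism -/

/-- Lebesgue measure on `ℝ₊`. -/
def lebesgue : Measure ℝ≥0 := (volume : Measure ℝ).comap ((↑) : ℝ≥0 → ℝ)

section Jump

variable {E : Type*} [MeasurableSpace E]

/-- The cumulated rate `∫₀ᵛ rate(ζ(w)) dw`, possibly infinite. -/
def cumRate (rate : E → ℝ≥0) (ζ : ℝ≥0 → E) (v : ℝ≥0) : ℝ≥0∞ :=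
  ∫⁻ w in Set.Iic v, (rate (ζ w) : ℝ≥0∞) ∂lebesgue

/-- `exp (-∫₀ᵛ rate(ζ(w)) dw)`, equal to `0` when the integral is infinite. -/
def survival (rate : E → ℝ≥0) (ζ : ℝ≥0 → E) (v : ℝ≥0) : ℝ≥0∞ :=
  EReal.exp (-((cumRate rate ζ v : ℝ≥0∞) : EReal))

/-- The measure `M(ζ; dy, dv) = rate(ζ(v)) exp (-∫₀ᵛ rate(ζ(w)) dw) Q(ζ(v); dy) dv`
on `E × ℝ₊`. -/
def jumpMeasure (rate : E → ℝ≥0) (Q : Kernel E E) (ζ : ℝ≥0 → E) : Measure (E × ℝ≥0) :=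
  (lebesgue.withDensity (fun v : ℝ≥0 => (rate (ζ v) : ℝ≥0∞) * survival rate ζ v)).bind
    (fun v : ℝ≥0 => (Q (ζ v)).map (fun y => (y, v)))

end Jump

/-! ### Switching processes -/

section SwitchingProcess

variable {E : Type*} [TopologicalSpace E] [MeasurableSpace E] {Ω : Type*}

/-- The σ-algebra generated by `ζ 0, …, ζ (k - 1)` and `(Y 0, T 0), …, (Y n, T n)`. -/
abbrev history (ζ : ℕ → Ω → CadlagPath E) (Y : ℕ → Ω → E) (T : ℕ → Ω → ℝ≥0) (k n : ℕ) :
    MeasurableSpace Ω :=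
  (⨆ i : ℕ, ⨆ _ : i < k, MeasurableSpace.comap (ζ i) inferInstance) ⊔
    (⨆ j : ℕ, ⨆ _ : j ≤ n, MeasurableSpace.comap (fun ω => (Y j ω, T j ω)) inferInstance)

/-- The construction of a switching process `X` with initial state `x₀` from the intrinsic laws
`law x` (law of `ζ` given `ζ(0) = x`) and the measure `M` given by `rate` and `Q`.
Here `ζ n` is the `(n + 1)`-st copy of the intrinsic process, which `X` follows between the jump
times `T n` and `T (n + 1)`, and `Y n` is the position just after the jump at time `T n`. -/
structure IsSwitchingConstruction {mΩ : MeasurableSpace Ω} (law : Kernel E (CadlagPath E))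
    (rate : E → ℝ≥0) (Q : Kernel E E) (x₀ : E) (μ : Measure Ω) (X : ℝ≥0 → Ω → E)
    (ζ : ℕ → Ω → CadlagPath E) (Y : ℕ → Ω → E) (T : ℕ → Ω → ℝ≥0) : Prop where
  measurable_path : ∀ n, Measurable (ζ n)
  measurable_position : ∀ n, Measurable (Y n)
  measurable_time : ∀ n, Measurable (T n)
  measurable_process : ∀ t, Measurable (X t)
  position_zero : ∀ ω, Y 0 ω = x₀
  time_zero : ∀ ω, T 0 ω = 0
  time_le : ∀ n ω, T n ω ≤ T (n + 1) ω
  /-- The law of `ζ n` given `ζ 0, …, ζ (n - 1)` and `(Y j, T j)`, `j ≤ n`, is `law (Y n)`. -/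
  condLaw_path : ∀ n, HasCondLaw μ (history ζ Y T n n) (ζ n) (fun ω => law (Y n ω))
  /-- The law of `(Y (n + 1), T (n + 1) - T n)` given `ζ 0, …, ζ n` and `(Y j, T j)`, `j ≤ n`,
  is `M(ζ n)`. -/
  condLaw_jump : ∀ n, HasCondLaw μ (history ζ Y T (n + 1) n)
    (fun ω => (Y (n + 1) ω, T (n + 1) ω - T n ω)) (fun ω => jumpMeasure rate Q (ζ n ω).1)
  /-- `X t = ζ n (t - T n)` for `T n ≤ t < T (n + 1)`. -/
  process_eq : ∀ᵐ ω ∂μ, ∀ n t, T n ω ≤ t → t < T (n + 1) ω → X t ω = (ζ n ω).1 (t - T n ω)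
  process_time : ∀ᵐ ω ∂μ, ∀ n, X (T n ω) ω = Y n ω
  /-- The jump times do not accumulate. -/
  tendsto_time : ∀ᵐ ω ∂μ, Tendsto (fun n => T n ω) atTop atTop

/-- Under `μ`, the process `X` is a switching process with initial state `x₀` associated with the
intrinsic laws `law` and the measure `M` given by `rate` and `Q`. -/
def IsSwitchingProcess {mΩ : MeasurableSpace Ω} (law : Kernel E (CadlagPath E))
    (rate : E → ℝ≥0) (Q : Kernel E E) (x₀ : E) (μ : Measure Ω) (X : ℝ≥0 → Ω → E) : Prop :=
  ∃ (ζ : ℕ → Ω → CadlagPath E) (Y : ℕ → Ω → E) (T : ℕ → Ω → ℝ≥0),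
    IsSwitchingConstruction law rate Q x₀ μ X ζ Y T

end SwitchingProcess

end Switching

end

noncomputable section

namespace Switching

/-! ### Lebesgue measure on the half-line -/

/-! Along a followed path `ζ`, the waiting time to the next jump has survival function `S(v) = exp
(-∫₀ᵛ rate(ζ))`, and `S(r + v)` is `S(r)` times the survival function of the path shifted by `r`.
So, when no jump has occurred by age `r`, the remaining jump mechanism is the one attached to the
path seen from `r` (`setLIntegral_jumpMeasure_Ioc`). By the Markov property of `ζ` on path space
(`IsMarkovFamily.hasCondLaw_shift`), that path has law `law (ζ r)` given the path before `r`. The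
future of a switching process therefore depends on its past only through the present position.

The transition function is built without reference to any switching process. Decomposing at the
first jump defines the kernels with exactly `n` jumps; their sum is a minimal kernel in the sense of
Feller. The Chapman–Kolmogorov equation follows by induction on the number of jumps
(`lintegral_jumpCount_add`). The minimal kernel is sub-Markov and may lose mass, for instance by
explosion. One Markov semigroup is needed for all initial states, so states from which mass is lost
are frozen. The other states are preserved by the minimal semigroup, and they contain every `x₀`
from which a switching process exists.

For a switching process, `T n → ∞` lets one sum over the number of jumps, and shows that after `T n`
the process follows the minimal kernel from `Y n` (`lintegral_restart`). For the Markov property at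
`s`, work on `T n ≤ s < T (n + 1)`. There an event of the past is an event of the first `n` paths,
the times up to `T n` and the current path stopped at age `s - T n` (`exists_set_of_past`).
Integrating out the next jump, then applying the Markov property of the current path at that age,
gives the minimal kernel started at `X s`. -/

theorem measurableEmbedding_nnreal_coe : MeasurableEmbedding ((↑) : ℝ≥0 → ℝ) :=
  MeasurableEmbedding.subtype_coe measurableSet_Ici

theorem map_coe_lebesgue : lebesgue.map ((↑) : ℝ≥0 → ℝ) = volume.restrict (Set.Ici 0) := by
  rw [lebesgue, measurableEmbedding_nnreal_coe.map_comap, NNReal.range_coe]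

theorem map_add_lebesgue (s : ℝ≥0) :
    lebesgue.map (fun v => s + v) = lebesgue.restrict (Set.Ici s) := by
  have hinj : Function.Injective (Measure.map ((↑) : ℝ≥0 → ℝ)) := fun a b h => by
    rw [← measurableEmbedding_nnreal_coe.comap_map a, h, measurableEmbedding_nnreal_coe.comap_map b]
  apply hinj
  have h1 : (((↑) : ℝ≥0 → ℝ) ∘ fun v => s + v) = (fun x : ℝ => (s : ℝ) + x) ∘ (↑) := by
    ext v; simp
  rw [Measure.map_map measurable_coe_nnreal_real (by fun_prop), h1,
    ← Measure.map_map (by fun_prop) measurable_coe_nnreal_real, map_coe_lebesgue]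
  have h2 : (Set.Ici s) = ((↑) : ℝ≥0 → ℝ) ⁻¹' Set.Ici (s : ℝ) := by ext v; simp
  rw [h2, ← Measure.restrict_map measurable_coe_nnreal_real measurableSet_Ici, map_coe_lebesgue,
    Measure.restrict_restrict measurableSet_Ici]
  have h3 : (Set.Ici (s : ℝ) ∩ Set.Ici 0) = Set.Ici (s : ℝ) :=
    Set.inter_eq_left.2 (Set.Ici_subset_Ici.2 s.2)
  have h4 : Set.Ici (0 : ℝ) = (fun x : ℝ => (s : ℝ) + x) ⁻¹' Set.Ici (s : ℝ) := by ext; simp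
  rw [h3, h4, ((measurePreserving_add_left volume (s : ℝ)).restrict_preimage
    measurableSet_Ici).map_eq]

theorem lintegral_Ici_lebesgue (s : ℝ≥0) (f : ℝ≥0 → ℝ≥0∞) :
    ∫⁻ v in Set.Ici s, f v ∂lebesgue = ∫⁻ v, f (s + v) ∂lebesgue := by
  rw [← map_add_lebesgue, MeasurableEmbedding.lintegral_map]
  refine MeasurableEmbedding.of_measurable_inverse_on_range (g := fun v => v - s) (by fun_prop)
    ?_ (by fun_prop) ?_
  · have : Set.range (fun v => s + v) = Set.Ici s := by
      ext v; exact ⟨by rintro ⟨w, rfl⟩; simp, fun h => ⟨v - s, add_tsub_cancel_of_le h⟩⟩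
    rw [this]; exact measurableSet_Ici
  · intro v; simp

instance nullSingletonClass_lebesgue : NullSingletonClass lebesgue where
  measure_singleton x := by
    rw [lebesgue, measurableEmbedding_nnreal_coe.comap_apply]; simp

theorem lintegral_Ioi_lebesgue (s : ℝ≥0) (f : ℝ≥0 → ℝ≥0∞) :
    ∫⁻ v in Set.Ioi s, f v ∂lebesgue = ∫⁻ v, f (s + v) ∂lebesgue := by
  rw [← lintegral_Ici_lebesgue]
  exact setLIntegral_congr Ioi_ae_eq_Ici

theorem lebesgue_Iic (t : ℝ≥0) : lebesgue (Set.Iic t) = t := by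
  have : ((↑) : ℝ≥0 → ℝ) '' Set.Iic t = Set.Icc 0 (t : ℝ) := by
    ext x
    exact ⟨by rintro ⟨v, hv, rfl⟩; exact ⟨v.2, hv⟩, fun h => ⟨⟨x, h.1⟩, h.2, rfl⟩⟩
  rw [lebesgue, measurableEmbedding_nnreal_coe.comap_apply, this]
  simp

instance sigmaFinite_lebesgue : SigmaFinite lebesgue where
  out' := ⟨⟨fun n : ℕ => Set.Iic (n : ℝ≥0), fun _ => trivial, fun n => by simp [lebesgue_Iic],
    Set.eq_univ_of_forall fun v => Set.mem_iUnion.2 (exists_nat_ge v)⟩⟩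

/-! ### Cumulated rate and survival -/

section Rate

variable {E : Type*} {rate : E → ℝ≥0} {ζ : ℝ≥0 → E}

theorem cumRate_add (rate : E → ℝ≥0) (ζ : ℝ≥0 → E) (s t : ℝ≥0) :
    cumRate rate ζ (s + t) = cumRate rate ζ s + cumRate rate (fun u => ζ (s + u)) t := by
  have h : Set.Iic (s + t) = Set.Iic s ∪ Set.Ioc s (s + t) :=
    (Set.Iic_union_Ioc_eq_Iic (by simp)).symm
  rw [cumRate, h, lintegral_union measurableSet_Ioc]
  · congr 1
    have := lintegral_Ioi_lebesgue s
      (fun u => (Set.Iic t).indicator (fun w => (rate (ζ (s + w)) : ℝ≥0∞)) (u - s))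
    simp only [add_tsub_cancel_left, lintegral_indicator measurableSet_Iic] at this
    rw [cumRate, ← this, ← Set.Ioi_inter_Iic, Set.inter_comm,
      ← setLIntegral_indicator measurableSet_Iic]
    refine setLIntegral_congr_fun measurableSet_Ioi fun u hu => ?_
    have hu' : s ≤ u := le_of_lt hu
    simp [Set.indicator_apply, add_comm t s, add_tsub_cancel_of_le hu']
  · exact Set.Iic_disjoint_Ioc le_rfl

theorem survival_eq_inv (rate : E → ℝ≥0) (ζ : ℝ≥0 → E) (v : ℝ≥0) :
    survival rate ζ v = (EReal.exp (cumRate rate ζ v : EReal))⁻¹ := by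
  rw [survival, EReal.exp_neg]

/-- The memoryless property of the jump clock; `ENNReal` inverses keep it valid when cumulated rates
are infinite. -/
theorem survival_add (rate : E → ℝ≥0) (ζ : ℝ≥0 → E) (s t : ℝ≥0) :
    survival rate ζ (s + t) = survival rate ζ s * survival rate (fun u => ζ (s + u)) t := by
  have h (x : ℝ≥0∞) : EReal.exp (x : EReal) ≠ 0 := by
    simp [EReal.exp_eq_zero_iff]
  simp only [survival_eq_inv, cumRate_add, EReal.coe_ennreal_add, EReal.exp_add]
  exact ENNReal.mul_inv (Or.inl (h _)) (Or.inr (h _))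

theorem survival_zero (rate : E → ℝ≥0) (ζ : ℝ≥0 → E) : survival rate ζ 0 = 1 := by
  have : cumRate rate ζ 0 = 0 := by
    rw [cumRate]
    exact setLIntegral_measure_zero _ _ (by simpa using lebesgue_Iic 0)
  simp [survival, this]

theorem survival_le_one (rate : E → ℝ≥0) (ζ : ℝ≥0 → E) (t : ℝ≥0) : survival rate ζ t ≤ 1 := by
  rw [survival, EReal.exp_le_one_iff]
  simp [EReal.coe_ennreal_nonneg]

theorem survival_eq_zero {t : ℝ≥0} (h : cumRate rate ζ t = ∞) : survival rate ζ t = 0 := by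
  simp [survival, h]

theorem survival_eq_ofReal {t : ℝ≥0} (h : cumRate rate ζ t ≠ ∞) :
    survival rate ζ t = ENNReal.ofReal (Real.exp (-(cumRate rate ζ t).toReal)) := by
  rw [survival, ← EReal.exp_coe, EReal.coe_neg, ← EReal.coe_ennreal_toReal h]

theorem cumRate_mono (rate : E → ℝ≥0) (ζ : ℝ≥0 → E) : Monotone (cumRate rate ζ) :=
  fun _ _ h => lintegral_mono_set (Set.Iic_subset_Iic.2 h)

theorem survival_anti (rate : E → ℝ≥0) (ζ : ℝ≥0 → E) : Antitone (survival rate ζ) := fun _ _ h =>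
  EReal.exp_monotone (EReal.neg_le_neg_iff.2 (EReal.coe_ennreal_le_coe_ennreal_iff.2
    (cumRate_mono rate ζ h)))

/-- Since `f` is only integrable, its primitive `F` is merely absolutely continuous. So is `exp
(-F)`, because `x ↦ exp (-x)` is Lipschitz on the bounded range of `F`, and the fundamental theorem
of calculus applies with the derivative `-f * exp (-F)` known almost everywhere. -/
theorem integral_mul_exp_neg_primitive {f : ℝ → ℝ} {t : ℝ}
    (hf : IntervalIntegrable f volume 0 t) :
    ∫ x in 0..t, f x * Real.exp (-∫ y in 0..x, f y) = 1 - Real.exp (-∫ y in 0..t, f y) := by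
  have hF := hf.absolutelyContinuousOnInterval_intervalIntegral (c := 0) (by simp)
  set F : ℝ → ℝ := fun x => ∫ y in 0..x, f y with hFdef
  obtain ⟨C, hC⟩ := hF.exists_bound
  have hlip : LipschitzOnWith (Real.exp C).toNNReal (fun x => Real.exp (-x))
      (Set.Icc (-C) C) := by
    refine Convex.lipschitzOnWith_of_nnnorm_hasDerivWithin_le (convex_Icc _ _)
      (f' := fun x => -Real.exp (-x)) (fun x _ => ?_) fun x hx => ?_
    · simpa [Function.comp_def] using
        ((Real.hasDerivAt_exp _).comp x (hasDerivAt_neg x)).hasDerivWithinAt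
    · rw [← NNReal.coe_le_coe, coe_nnnorm, norm_neg, Real.norm_of_nonneg (Real.exp_pos _).le,
        Real.coe_toNNReal _ (Real.exp_pos _).le, Real.exp_le_exp]
      linarith [hx.1]
  have hG : AbsolutelyContinuousOnInterval (fun x => Real.exp (-F x)) 0 t := by
    refine squeeze_zero' (.of_forall fun E => Finset.sum_nonneg fun i _ => dist_nonneg) ?_
      (by simpa using Tendsto.const_mul (Real.exp C) hF)
    refine eventually_inf_principal.2 (.of_forall fun E hE => ?_)
    rw [Finset.mul_sum]
    refine Finset.sum_le_sum fun i hi => ?_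
    have h := hlip.dist_le_mul (F (E.2 i).1) (abs_le.1 (hC _ (hE.1 i hi).1))
      (F (E.2 i).2) (abs_le.1 (hC _ (hE.1 i hi).2))
    rwa [Real.coe_toNNReal _ (Real.exp_pos _).le] at h
  have h := hG.integral_deriv_eq_sub
  have h0 : F 0 = 0 := by simp [hFdef]
  rw [h0, neg_zero, Real.exp_zero] at h
  rw [← neg_sub, ← h, ← intervalIntegral.integral_neg]
  refine intervalIntegral.integral_congr_ae ?_
  filter_upwards [hf.ae_hasDerivAt_integral] with x hx hxt
  have hd := ((Real.hasDerivAt_exp _).comp x (hx (Set.uIoc_subset_uIcc hxt) 0 (by simp)).neg).deriv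
  simp only [Function.comp_def, Pi.neg_apply] at hd
  rw [hd]
  ring

theorem setLIntegral_lebesgue_eq (g : ℝ → ℝ≥0∞) (t : ℝ≥0) :
    ∫⁻ v in Set.Iic t, g v ∂lebesgue = ∫⁻ x in Set.Ioc 0 (t : ℝ), g x := by
  have h : Set.Iic t = ((↑) : ℝ≥0 → ℝ) ⁻¹' Set.Iic (t : ℝ) := by ext v; simp
  rw [h, ← measurableEmbedding_nnreal_coe.lintegral_map, ← Measure.restrict_map
    measurable_coe_nnreal_real measurableSet_Iic, map_coe_lebesgue,
    Measure.restrict_restrict measurableSet_Iic, Set.inter_comm, Set.Ici_inter_Iic]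
  exact setLIntegral_congr Ioc_ae_eq_Icc.symm

theorem setLIntegral_rate_mul_survival_of_ne_top (hζ : Measurable fun v => rate (ζ v)) {t : ℝ≥0}
    (ht : cumRate rate ζ t ≠ ∞) :
    ∫⁻ v in Set.Iic t, (rate (ζ v) : ℝ≥0∞) * survival rate ζ v ∂lebesgue =
      1 - survival rate ζ t := by
  set f : ℝ → ℝ := fun x => rate (ζ x.toNNReal) with hf
  have hfm : Measurable f := by
    have : Measurable fun x : ℝ => rate (ζ x.toNNReal) := hζ.comp measurable_real_toNNReal
    exact measurable_coe_nnreal_real.comp this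
  have hf0 (x : ℝ) : 0 ≤ f x := NNReal.coe_nonneg _
  have hcum (v : ℝ≥0) : cumRate rate ζ v = ∫⁻ x in Set.Ioc 0 (v : ℝ), ENNReal.ofReal (f x) := by
    rw [← setLIntegral_lebesgue_eq]
    simp [cumRate, hf]
  have hint (v : ℝ≥0) (hv : v ≤ t) : IntegrableOn f (Set.Ioc 0 (v : ℝ)) := by
    refine ⟨hfm.aestronglyMeasurable, ?_⟩
    rw [hasFiniteIntegral_iff_ofReal (.of_forall hf0), ← hcum]
    exact (cumRate_mono rate ζ hv).trans_lt ht.lt_top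
  have hreal (v : ℝ≥0) (hv : v ≤ t) : (cumRate rate ζ v).toReal = ∫ x in 0..(v : ℝ), f x := by
    rw [intervalIntegral.integral_of_le v.coe_nonneg, hcum,
      integral_eq_lintegral_of_nonneg_ae (.of_forall hf0) hfm.aestronglyMeasurable]
  have hsurv (v : ℝ≥0) (hv : v ≤ t) :
      survival rate ζ v = ENNReal.ofReal (Real.exp (-∫ x in 0..(v : ℝ), f x)) := by
    rw [survival_eq_ofReal, hreal v hv]
    exact ((cumRate_mono rate ζ hv).trans_lt ht.lt_top).ne
  have hII : IntervalIntegrable f volume 0 t :=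
    (intervalIntegrable_iff_integrableOn_Ioc_of_le t.2).2 (hint t le_rfl)
  have hexp : ContinuousOn (fun x => Real.exp (-∫ y in 0..x, f y)) (Set.uIcc 0 (t : ℝ)) :=
    Real.continuous_exp.comp_continuousOn
      (hII.absolutelyContinuousOnInterval_intervalIntegral (c := 0) (by simp)).continuousOn.neg
  have hII' := hII.mul_continuousOn hexp
  calc ∫⁻ v in Set.Iic t, (rate (ζ v) : ℝ≥0∞) * survival rate ζ v ∂lebesgue
      = ∫⁻ v in Set.Iic t, ENNReal.ofReal (f v * Real.exp (-∫ y in 0..(v : ℝ), f y)) ∂lebesgue := by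
        refine setLIntegral_congr_fun measurableSet_Iic fun v hv => ?_
        simp [hsurv v hv, hf]
    _ = ∫⁻ x in Set.Ioc 0 (t : ℝ), ENNReal.ofReal (f x * Real.exp (-∫ y in 0..x, f y)) :=
        setLIntegral_lebesgue_eq
          (fun x => ENNReal.ofReal (f x * Real.exp (-∫ y in 0..x, f y))) t
    _ = ENNReal.ofReal (∫ x in 0..(t : ℝ), f x * Real.exp (-∫ y in 0..x, f y)) := by
        rw [intervalIntegral.integral_of_le t.coe_nonneg, ofReal_integral_eq_lintegral_ofReal]
        · exact (intervalIntegrable_iff_integrableOn_Ioc_of_le t.2).1 hII'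
        · exact .of_forall fun x => mul_nonneg (hf0 x) (Real.exp_pos _).le
    _ = 1 - survival rate ζ t := by
        rw [integral_mul_exp_neg_primitive hII, ENNReal.ofReal_sub _ (Real.exp_pos _).le,
          hsurv t le_rfl, ENNReal.ofReal_one]

theorem measurable_survival_path (rate : E → ℝ≥0) (ζ : ℝ≥0 → E) : Measurable (survival rate ζ) :=
  (survival_anti rate ζ).measurable

/-- The primitive formula needs a finite cumulated rate. Truncating the rate at `k` makes it at most
`k * t` and only raises the survival function; monotone convergence in `k` then removes the
truncation from the remaining factor. -/
theorem setLIntegral_rate_mul_survival_le_one (hζ : Measurable fun v => rate (ζ v)) (t : ℝ≥0) :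
    ∫⁻ v in Set.Iic t, (rate (ζ v) : ℝ≥0∞) * survival rate ζ v ∂lebesgue ≤ 1 := by
  have htrunc (k : ℕ) :
      ∫⁻ v in Set.Iic t, ((min (rate (ζ v)) k : ℝ≥0) : ℝ≥0∞) * survival rate ζ v ∂lebesgue ≤ 1 := by
    set rk : E → ℝ≥0 := fun x => min (rate x) k with hrk
    have hk : cumRate rk ζ t ≠ ∞ := by
      refine ne_top_of_le_ne_top (b := (k : ℝ≥0∞) * t) (by finiteness) ?_
      calc cumRate rk ζ t ≤ ∫⁻ w in Set.Iic t, (k : ℝ≥0∞) ∂lebesgue := by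
            refine lintegral_mono fun w => ?_
            have : rk (ζ w) ≤ (k : ℝ≥0) := min_le_right _ _
            simpa using ENNReal.coe_le_coe.2 this
        _ = k * t := by rw [setLIntegral_const, lebesgue_Iic]
    calc ∫⁻ v in Set.Iic t, ((min (rate (ζ v)) k : ℝ≥0) : ℝ≥0∞) * survival rate ζ v ∂lebesgue
        ≤ ∫⁻ v in Set.Iic t, (rk (ζ v) : ℝ≥0∞) * survival rk ζ v ∂lebesgue := by
          refine lintegral_mono fun v => mul_le_mul_right (EReal.exp_monotone
            (EReal.neg_le_neg_iff.2 (EReal.coe_ennreal_le_coe_ennreal_iff.2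
              (lintegral_mono fun w => ?_)))) _
          exact ENNReal.coe_le_coe.2 (min_le_left _ _)
      _ = 1 - survival rk ζ t :=
          setLIntegral_rate_mul_survival_of_ne_top (hζ.min measurable_const) hk
      _ ≤ 1 := tsub_le_self
  have hsup (v : ℝ≥0) : (rate (ζ v) : ℝ≥0∞) * survival rate ζ v =
      ⨆ k : ℕ, ((min (rate (ζ v)) k : ℝ≥0) : ℝ≥0∞) * survival rate ζ v := by
    refine le_antisymm ?_ (iSup_le fun k =>
      mul_le_mul_left (ENNReal.coe_le_coe.2 (min_le_left _ _)) _)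
    obtain ⟨k, hk⟩ := exists_nat_ge (rate (ζ v))
    refine le_iSup_of_le k ?_
    rw [min_eq_left hk]
  simp_rw [hsup]
  rw [lintegral_iSup]
  · exact iSup_le htrunc
  · intro k
    exact ((hζ.min measurable_const).coe_nnreal_ennreal).mul (measurable_survival_path _ _)
  · intro k l hkl v
    refine mul_le_mul_left (ENNReal.coe_le_coe.2 (min_le_min le_rfl ?_)) _
    exact_mod_cast hkl

/-- Only an inequality holds: if the cumulated rate passes from finite to infinite immediately after
some time, the survival function drops to `0` with no jump density accounting for the drop. -/
theorem setLIntegral_rate_mul_survival_add_le (hζ : Measurable fun v => rate (ζ v)) (t : ℝ≥0) :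
    ∫⁻ v in Set.Iic t, (rate (ζ v) : ℝ≥0∞) * survival rate ζ v ∂lebesgue + survival rate ζ t ≤
      1 := by
  by_cases ht : cumRate rate ζ t = ∞
  · rw [survival_eq_zero ht, add_zero]
    exact setLIntegral_rate_mul_survival_le_one hζ t
  · rw [setLIntegral_rate_mul_survival_of_ne_top hζ ht,
      tsub_add_cancel_of_le (survival_le_one _ _ _)]

theorem lintegral_rate_mul_survival_le_one (hζ : Measurable fun v => rate (ζ v)) :
    ∫⁻ v, (rate (ζ v) : ℝ≥0∞) * survival rate ζ v ∂lebesgue ≤ 1 := by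
  have hmono : Monotone fun n : ℕ => Set.Iic (n : ℝ≥0) := fun a b h =>
    Set.Iic_subset_Iic.2 (by exact_mod_cast h)
  have huniv : (⋃ n : ℕ, Set.Iic (n : ℝ≥0)) = Set.univ :=
    Set.eq_univ_of_forall fun v => Set.mem_iUnion.2 (exists_nat_ge v)
  rw [← setLIntegral_univ, ← huniv, setLIntegral_iUnion_of_directed _ hmono.directed_le]
  exact iSup_le fun n => setLIntegral_rate_mul_survival_le_one hζ _

/-- Subtract the formula on `Iic t` from the total mass one; once the cumulated rate is infinite,
both sides vanish. -/
theorem setLIntegral_Ioi_rate_mul_survival (hζ : Measurable fun v => rate (ζ v))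
    (htot : ∫⁻ v, (rate (ζ v) : ℝ≥0∞) * survival rate ζ v ∂lebesgue = 1) (t : ℝ≥0) :
    ∫⁻ v in Set.Ioi t, (rate (ζ v) : ℝ≥0∞) * survival rate ζ v ∂lebesgue = survival rate ζ t := by
  by_cases ht : cumRate rate ζ t = ∞
  · rw [survival_eq_zero ht, setLIntegral_congr_fun (g := 0) measurableSet_Ioi, Pi.zero_def,
      lintegral_zero]
    intro v hv
    have : cumRate rate ζ v = ∞ := top_le_iff.1 (ht ▸ cumRate_mono rate ζ (le_of_lt hv))
    simp [survival_eq_zero this]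
  · have h := lintegral_add_compl (μ := lebesgue)
      (fun v => (rate (ζ v) : ℝ≥0∞) * survival rate ζ v) (measurableSet_Iic (a := t))
    rw [htot, setLIntegral_rate_mul_survival_of_ne_top hζ ht, Set.compl_Iic] at h
    have hs := survival_le_one rate ζ t
    have hne : (1 - survival rate ζ t) ≠ ∞ := ne_top_of_le_ne_top ENNReal.one_ne_top tsub_le_self
    exact (ENNReal.add_right_inj hne).1 (h.trans (tsub_add_cancel_of_le hs).symm)

end Rate


/-! ### The space of càdlàg paths -/

section Path

variable {E : Type*} [TopologicalSpace E]

/-- The path `u ↦ ζ (r + u)`. -/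
def shift (r : ℝ≥0) (ζ : CadlagPath E) : CadlagPath E :=
  ⟨fun u => ζ.1 (r + u), fun t => by
    refine ⟨ContinuousWithinAt.comp (t := Set.Ici (r + t)) (ζ.2 (r + t)).1
      (by fun_prop) fun u hu => add_le_add_right hu r, fun ht => ?_⟩
    obtain ⟨l, hl⟩ := (ζ.2 (r + t)).2 (ht.trans_le le_add_self)
    refine ⟨l, hl.comp (tendsto_nhdsWithin_iff.2 ⟨?_, ?_⟩)⟩
    · exact ((continuous_const.add continuous_id).tendsto t).mono_left nhdsWithin_le_nhds
    · filter_upwards [self_mem_nhdsWithin] with u hu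
      exact add_lt_add_right hu r⟩

@[simp]
theorem shift_apply (r : ℝ≥0) (ζ : CadlagPath E) (u : ℝ≥0) : (shift r ζ).1 u = ζ.1 (r + u) := rfl

/-- The path `ζ` stopped at the time `r`. -/
def stopAt (r : ℝ≥0) (ζ : CadlagPath E) : CadlagPath E :=
  ⟨fun u => ζ.1 (min u r), fun t => by
    refine ⟨ContinuousWithinAt.comp (t := Set.Ici (min t r)) (ζ.2 (min t r)).1
      (by fun_prop) fun u hu => min_le_min_right r hu, fun ht => ?_⟩
    rcases le_or_gt t r with htr | htr
    · obtain ⟨l, hl⟩ := (ζ.2 t).2 ht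
      refine ⟨l, hl.congr' ?_⟩
      filter_upwards [self_mem_nhdsWithin] with u hu
      rw [min_eq_left (le_of_lt (lt_of_lt_of_le hu htr))]
    · refine ⟨ζ.1 r, tendsto_const_nhds.congr' ?_⟩
      filter_upwards [Ioo_mem_nhdsLT htr] with u hu
      rw [min_eq_right hu.1.le]⟩

theorem stop_apply (r : ℝ≥0) (ζ : CadlagPath E) (u : ℝ≥0) : (stopAt r ζ).1 u = ζ.1 (min u r) := rfl

theorem stop_apply_of_le {r u : ℝ≥0} (h : u ≤ r) (ζ : CadlagPath E) :
    (stopAt r ζ).1 u = ζ.1 u := by rw [stop_apply, min_eq_left h]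

/-- The constant path. -/
def constPath (x : E) : CadlagPath E :=
  ⟨fun _ => x, fun _ => ⟨continuousWithinAt_const, fun _ => ⟨x, tendsto_const_nhds⟩⟩⟩

/-- Makes survival up to `r` a function of the path stopped at `r`, hence an admissible weight when
conditioning on the past at `r`. -/
theorem cumRate_stop (rate : E → ℝ≥0) (ζ : CadlagPath E) (r : ℝ≥0) :
    cumRate rate (stopAt r ζ).1 r = cumRate rate ζ.1 r :=
  setLIntegral_congr_fun measurableSet_Iic fun w hw => by
    rw [stop_apply_of_le (Set.mem_Iic.1 hw)]

theorem survival_stop (rate : E → ℝ≥0) (ζ : CadlagPath E) (r : ℝ≥0) :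
    survival rate (stopAt r ζ).1 r = survival rate ζ.1 r := by
  simp only [survival, cumRate_stop]

variable [MeasurableSpace E]

@[fun_prop]
theorem measurable_eval (t : ℝ≥0) : Measurable fun ζ : CadlagPath E => ζ.1 t :=
  (measurable_pi_apply t).comp measurable_subtype_coe

theorem measurable_path_iff {α : Type*} {mα : MeasurableSpace α} {f : α → CadlagPath E} :
    Measurable f ↔ ∀ t, Measurable fun a => (f a).1 t :=
  ⟨fun h t => (measurable_eval t).comp h, fun h => (measurable_pi_iff.2 h).subtype_mk⟩

variable [BorelSpace E] [TopologicalSpace.PseudoMetrizableSpace E]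

/-- By right-continuity, evaluation is a pointwise limit of evaluations on countable grids
approached from the right. -/
theorem measurable_eval_prod : Measurable fun p : CadlagPath E × ℝ≥0 => p.1.1 p.2 := by
  -- For `k = ⌊t (n + 1)⌋` this point lies between `t` and `t + 1 / (n + 1)`; the `+ 1` in the
  -- numerator keeps it on the right of `t`.
  let a (n : ℕ) (k : ℕ) : ℝ≥0 := (k + 1) / (n + 1)
  have hm (n : ℕ) : Measurable fun p : CadlagPath E × ℝ≥0 => p.1.1 (a n ⌊p.2 * (n + 1)⌋₊) := by
    have h1 : Measurable fun q : CadlagPath E × ℕ => q.1.1 (a n q.2) :=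
      measurable_from_prod_countable_left fun k => measurable_eval (a n k)
    exact h1.comp (measurable_fst.prodMk (Nat.measurable_floor.comp (by fun_prop)))
  refine measurable_of_tendsto_metrizable hm (tendsto_pi_nhds.2 fun p => ?_)
  have hle (n : ℕ) : p.2 ≤ a n ⌊p.2 * (n + 1)⌋₊ := by
    rw [le_div_iff₀ (by positivity)]
    exact (Nat.lt_floor_add_one _).le
  have hup (n : ℕ) : a n ⌊p.2 * (n + 1)⌋₊ ≤ p.2 + 1 / (n + 1) := by
    rw [div_le_iff₀ (by positivity), add_mul, one_div_mul_cancel (by positivity)]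
    gcongr
    exact Nat.floor_le (by positivity)
  have ht : Tendsto (fun n : ℕ => a n ⌊p.2 * (n + 1)⌋₊) atTop (𝓝 p.2) := by
    refine tendsto_of_tendsto_of_tendsto_of_le_of_le tendsto_const_nhds ?_ hle hup
    simpa using (tendsto_const_nhds (x := p.2)).add
      (tendsto_one_div_add_atTop_nhds_zero_nat (𝕜 := ℝ≥0))
  exact (p.1.2 p.2).1.tendsto.comp
    (tendsto_nhdsWithin_iff.2 ⟨ht, .of_forall hle⟩)

@[fun_prop]
theorem measurable_eval_comp {α : Type*} {mα : MeasurableSpace α} {f : α → CadlagPath E}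
    {g : α → ℝ≥0} (hf : Measurable f) (hg : Measurable g) : Measurable fun a => (f a).1 (g a) :=
  measurable_eval_prod.comp (hf.prodMk hg)

theorem measurable_path (ζ : CadlagPath E) : Measurable ζ.1 :=
  measurable_eval_comp measurable_const measurable_id

@[fun_prop]
theorem measurable_shift_comp {α : Type*} {mα : MeasurableSpace α} {f : α → CadlagPath E}
    {g : α → ℝ≥0} (hf : Measurable f) (hg : Measurable g) :
    Measurable fun a => shift (g a) (f a) :=
  measurable_path_iff.2 fun t =>
    show Measurable fun a => (f a).1 (g a + t) from measurable_eval_comp hf (hg.add_const t)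

@[fun_prop]
theorem measurable_stop_comp {α : Type*} {mα : MeasurableSpace α} {f : α → CadlagPath E}
    {g : α → ℝ≥0} (hf : Measurable f) (hg : Measurable g) :
    Measurable fun a => stopAt (g a) (f a) :=
  measurable_path_iff.2 fun t =>
    show Measurable fun a => (f a).1 (min t (g a)) from
      measurable_eval_comp hf (measurable_const.min hg)

/-! ### The jump measure -/

theorem measurable_cumRate_comp {rate : E → ℝ≥0} (hrate : Measurable rate) {α : Type*}
    {mα : MeasurableSpace α} {f : α → CadlagPath E} {g : α → ℝ≥0} (hf : Measurable f)
    (hg : Measurable g) : Measurable fun a => cumRate rate (f a).1 (g a) := by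
  have h (a : α) : cumRate rate (f a).1 (g a) =
      ∫⁻ w, (if w ≤ g a then (rate ((f a).1 w) : ℝ≥0∞) else 0) ∂lebesgue := by
    rw [cumRate, ← lintegral_indicator measurableSet_Iic]
    rfl
  simp_rw [h]
  refine Measurable.lintegral_prod_right' (f := fun p : α × ℝ≥0 =>
    if p.2 ≤ g p.1 then (rate ((f p.1).1 p.2) : ℝ≥0∞) else 0) ?_
  refine Measurable.ite (measurableSet_le measurable_snd (hg.comp measurable_fst)) ?_
    measurable_const
  exact (hrate.comp (measurable_eval_comp (hf.comp measurable_fst) measurable_snd)).coe_nnreal_ennreal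

theorem measurable_survival_comp {rate : E → ℝ≥0} (hrate : Measurable rate) {α : Type*}
    {mα : MeasurableSpace α} {f : α → CadlagPath E} {g : α → ℝ≥0} (hf : Measurable f)
    (hg : Measurable g) : Measurable fun a => survival rate (f a).1 (g a) :=
  EReal.exp_monotone.measurable.comp
    (measurable_cumRate_comp hrate hf hg).coe_ereal_ennreal.neg

end Path

section JumpMeasure

variable {E : Type*} [MeasurableSpace E] {rate : E → ℝ≥0} {ζ : ℝ≥0 → E}

theorem lintegral_jumpMeasure (hrate : Measurable rate) (Q : Kernel E E) [IsSFiniteKernel Q]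
    (hζ : Measurable ζ) {F : E × ℝ≥0 → ℝ≥0∞} (hF : Measurable F) :
    ∫⁻ p, F p ∂jumpMeasure rate Q ζ =
      ∫⁻ v, (rate (ζ v) : ℝ≥0∞) * survival rate ζ v * ∫⁻ y, F (y, v) ∂Q (ζ v) ∂lebesgue := by
  have hQ : Measurable fun v : ℝ≥0 => (Q (ζ v)).map (fun y => (y, v)) := by
    refine Measure.measurable_of_measurable_coe _ fun B hB => ?_
    have : ∀ v : ℝ≥0, (Q (ζ v)).map (fun y => (y, v)) B =
        Q.comap ζ hζ v (Prod.mk v ⁻¹' (Prod.swap ⁻¹' B)) := fun v => by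
      rw [Measure.map_apply (by fun_prop) hB]; rfl
    simp_rw [this]
    exact Kernel.measurable_kernel_prodMk_left (measurable_swap hB)
  have hin : Measurable fun v : ℝ≥0 => ∫⁻ y, F (y, v) ∂Q (ζ v) := by
    have : Measurable fun v : ℝ≥0 => ∫⁻ y, F (y, v) ∂(Q.comap ζ hζ v) :=
      Measurable.lintegral_kernel_prod_right (f := fun v y => F (y, v)) (by fun_prop)
    exact this
  rw [jumpMeasure, Measure.lintegral_bind hQ.aemeasurable hF.aemeasurable,
    lintegral_withDensity_eq_lintegral_mul _ ?_ ?_]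
  · refine lintegral_congr fun v => ?_
    rw [Pi.mul_apply, lintegral_map hF (by fun_prop)]
  · exact (hrate.comp hζ).coe_nnreal_ennreal.mul (measurable_survival_path _ _)
  · convert hin using 2 with v
    rw [lintegral_map hF (by fun_prop)]

theorem setLIntegral_jumpMeasure (hrate : Measurable rate) (Q : Kernel E E) [IsSFiniteKernel Q]
    (hζ : Measurable ζ) {F : E × ℝ≥0 → ℝ≥0∞} (hF : Measurable F) {S : Set ℝ≥0}
    (hS : MeasurableSet S) :
    ∫⁻ p in Prod.snd ⁻¹' S, F p ∂jumpMeasure rate Q ζ =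
      ∫⁻ v in S, (rate (ζ v) : ℝ≥0∞) * survival rate ζ v * ∫⁻ y, F (y, v) ∂Q (ζ v) ∂lebesgue := by
  rw [← lintegral_indicator (measurable_snd hS), lintegral_jumpMeasure hrate Q hζ
    (hF.indicator (measurable_snd hS)), ← lintegral_indicator hS]
  refine lintegral_congr fun v => ?_
  by_cases hv : v ∈ S <;> simp [hv]

variable (Q : Kernel E E) [IsMarkovKernel Q]

theorem jumpMeasure_snd (hrate : Measurable rate) (hζ : Measurable ζ) {S : Set ℝ≥0}
    (hS : MeasurableSet S) :
    jumpMeasure rate Q ζ (Prod.snd ⁻¹' S) =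
      ∫⁻ v in S, (rate (ζ v) : ℝ≥0∞) * survival rate ζ v ∂lebesgue := by
  rw [← setLIntegral_one, setLIntegral_jumpMeasure hrate Q hζ measurable_const hS]
  simp

theorem jumpMeasure_univ_le (hrate : Measurable rate) (hζ : Measurable ζ) :
    jumpMeasure rate Q ζ Set.univ ≤ 1 := by
  rw [← Set.preimage_univ (f := Prod.snd), jumpMeasure_snd Q hrate hζ .univ, setLIntegral_univ]
  exact lintegral_rate_mul_survival_le_one (hrate.comp hζ)

theorem jumpMeasure_Ioi (hrate : Measurable rate) (hζ : Measurable ζ)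
    (h1 : jumpMeasure rate Q ζ Set.univ = 1) (t : ℝ≥0) :
    jumpMeasure rate Q ζ (Prod.snd ⁻¹' Set.Ioi t) = survival rate ζ t := by
  rw [jumpMeasure_snd Q hrate hζ measurableSet_Ioi]
  refine setLIntegral_Ioi_rate_mul_survival (hrate.comp hζ) ?_ t
  rwa [← Set.preimage_univ (f := Prod.snd), jumpMeasure_snd Q hrate hζ .univ,
    setLIntegral_univ] at h1

theorem jumpMeasure_Iic_add_survival_le (hrate : Measurable rate) (hζ : Measurable ζ) (t : ℝ≥0) :
    jumpMeasure rate Q ζ (Prod.snd ⁻¹' Set.Iic t) + survival rate ζ t ≤ 1 := by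
  rw [jumpMeasure_snd Q hrate hζ measurableSet_Iic]
  exact setLIntegral_rate_mul_survival_add_le (hrate.comp hζ) t

/-- Shifting the path by `r` conditions the jump mechanism on no jump before `r`. -/
theorem setLIntegral_jumpMeasure_Ioc (hrate : Measurable rate) (hζ : Measurable ζ)
    {F : E × ℝ≥0 → ℝ≥0∞} (hF : Measurable F) (r t : ℝ≥0) :
    ∫⁻ p in Prod.snd ⁻¹' Set.Ioc r (r + t), F (p.1, r + t - p.2) ∂jumpMeasure rate Q ζ =
      survival rate ζ r * ∫⁻ p in Prod.snd ⁻¹' Set.Iic t, F (p.1, t - p.2)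
        ∂jumpMeasure rate Q (fun u => ζ (r + u)) := by
  have hζr : Measurable fun u => ζ (r + u) := hζ.comp (by fun_prop)
  have hmeas (g : ℝ≥0 → E) (hg : Measurable g) (c : ℝ≥0) : Measurable fun v : ℝ≥0 =>
      (rate (g v) : ℝ≥0∞) * survival rate g v * ∫⁻ y, F (y, c - v) ∂Q (g v) := by
    refine ((hrate.comp hg).coe_nnreal_ennreal.mul (measurable_survival_path _ _)).mul ?_
    have : Measurable fun v : ℝ≥0 => ∫⁻ y, F (y, c - v) ∂(Q.comap g hg v) :=
      Measurable.lintegral_kernel_prod_right (f := fun v y => F (y, c - v)) (by fun_prop)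
    exact this
  rw [setLIntegral_jumpMeasure hrate Q hζ (by fun_prop) measurableSet_Ioc,
    setLIntegral_jumpMeasure hrate Q hζr (by fun_prop) measurableSet_Iic,
    ← lintegral_const_mul _ (hmeas _ hζr t), ← Set.Ioi_inter_Iic, Set.inter_comm,
    ← setLIntegral_indicator measurableSet_Iic, lintegral_Ioi_lebesgue,
    ← lintegral_indicator measurableSet_Iic]
  refine lintegral_congr fun v => ?_
  by_cases hv : v ≤ t
  · simp only [Set.indicator_apply, Set.mem_Iic, add_le_add_iff_left, hv, if_true,
      survival_add rate ζ r v, add_tsub_add_eq_tsub_left]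
    ring
  · simp [hv]

end JumpMeasure

/-! ### The jump mechanism as kernels on path space -/

section JumpKernel

variable {E : Type*} [TopologicalSpace E] [MeasurableSpace E] [BorelSpace E]
  [TopologicalSpace.PseudoMetrizableSpace E] {rate : E → ℝ≥0}

/-- The jump measure, as a kernel from paths to pairs (position after the jump, time). -/
def jumpKernel (hrate : Measurable rate) (Q : Kernel E E) [IsMarkovKernel Q] :
    Kernel (CadlagPath E) (E × ℝ≥0) where
  toFun ζ := jumpMeasure rate Q ζ.1
  measurable' := by
    refine Measure.measurable_of_measurable_coe _ fun B hB => ?_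
    have h (ζ : CadlagPath E) := lintegral_jumpMeasure hrate Q (measurable_path ζ)
      (measurable_one.indicator hB)
    simp_rw [lintegral_indicator_one hB] at h
    simp_rw [h]
    refine Measurable.lintegral_prod_right' (f := fun p : CadlagPath E × ℝ≥0 =>
      (rate (p.1.1 p.2) : ℝ≥0∞) * survival rate p.1.1 p.2 *
        ∫⁻ y, B.indicator 1 (y, p.2) ∂Q (p.1.1 p.2)) ?_
    refine (((hrate.comp measurable_eval_prod).coe_nnreal_ennreal.mul
      (measurable_survival_comp hrate measurable_fst measurable_snd))).mul ?_
    have : Measurable fun p : CadlagPath E × ℝ≥0 =>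
        ∫⁻ y, B.indicator 1 (y, p.2) ∂(Q.comap _ measurable_eval_prod p) :=
      Measurable.lintegral_kernel_prod_right
        (f := fun (p : CadlagPath E × ℝ≥0) y => B.indicator (1 : E × ℝ≥0 → ℝ≥0∞) (y, p.2))
        ((measurable_one.indicator hB).comp (by fun_prop))
    exact this

variable (hrate : Measurable rate) (Q : Kernel E E) [IsMarkovKernel Q]

theorem jumpKernel_apply (ζ : CadlagPath E) :
    jumpKernel hrate Q ζ = jumpMeasure rate Q ζ.1 := rfl

instance isFiniteKernel_jumpKernel : IsFiniteKernel (jumpKernel hrate Q) :=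
  ⟨1, ENNReal.one_lt_top, fun ζ => jumpMeasure_univ_le Q hrate (measurable_path ζ)⟩

/-- Starting on the path `ζ`, with remaining time `t`: the position at `t` if there is no jump
before `t`. -/
def stayKernel (hrate : Measurable rate) : Kernel (CadlagPath E × ℝ≥0) E where
  toFun p := survival rate p.1.1 p.2 • Measure.dirac (p.1.1 p.2)
  measurable' := by
    refine Measure.measurable_of_measurable_coe _ fun B hB => ?_
    simp only [Measure.smul_apply, smul_eq_mul]
    exact (measurable_survival_comp hrate measurable_fst measurable_snd).mul
      ((Measure.measurable_coe hB).comp (Measure.measurable_dirac.comp measurable_eval_prod))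

theorem lintegral_stayKernel (p : CadlagPath E × ℝ≥0) {f : E → ℝ≥0∞} (hf : Measurable f) :
    ∫⁻ y, f y ∂stayKernel hrate p = survival rate p.1.1 p.2 * f (p.1.1 p.2) := by
  have : stayKernel hrate p = survival rate p.1.1 p.2 • Measure.dirac (p.1.1 p.2) := rfl
  rw [this, lintegral_smul_measure, lintegral_dirac' _ hf, smul_eq_mul]

/-- Starting on the path `ζ`, with remaining time `t`: the position after the first jump and the
time which then remains, if that jump occurs before `t`. -/
def jumpBeforeKernel : Kernel (CadlagPath E × ℝ≥0) (E × ℝ≥0) where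
  toFun p := ((jumpKernel hrate Q p.1).restrict (Prod.snd ⁻¹' Set.Iic p.2)).map
    fun q => (q.1, p.2 - q.2)
  measurable' := by
    refine Measure.measurable_of_measurable_coe _ fun B hB => ?_
    have h (p : CadlagPath E × ℝ≥0) :
        (((jumpKernel hrate Q p.1).restrict (Prod.snd ⁻¹' Set.Iic p.2)).map
          fun q => (q.1, p.2 - q.2)) B = (jumpKernel hrate Q).prodMkRight ℝ≥0 p
            (Prod.mk p ⁻¹' {z : (CadlagPath E × ℝ≥0) × (E × ℝ≥0) |
              (z.2.1, z.1.2 - z.2.2) ∈ B ∧ z.2.2 ≤ z.1.2}) := by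
      rw [Measure.map_apply (by fun_prop) hB, Measure.restrict_apply
        ((show Measurable fun q : E × ℝ≥0 => (q.1, p.2 - q.2) by fun_prop) hB)]
      rfl
    simp_rw [h]
    refine Kernel.measurable_kernel_prodMk_left ?_
    exact ((show Measurable fun z : (CadlagPath E × ℝ≥0) × (E × ℝ≥0) =>
      (z.2.1, z.1.2 - z.2.2) by fun_prop) hB).inter
        (measurableSet_le (by fun_prop) (by fun_prop))

theorem lintegral_jumpBeforeKernel (p : CadlagPath E × ℝ≥0) {f : E × ℝ≥0 → ℝ≥0∞}
    (hf : Measurable f) :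
    ∫⁻ q, f q ∂jumpBeforeKernel hrate Q p =
      ∫⁻ q in Prod.snd ⁻¹' Set.Iic p.2, f (q.1, p.2 - q.2) ∂jumpMeasure rate Q p.1.1 := by
  have : jumpBeforeKernel hrate Q p = ((jumpKernel hrate Q p.1).restrict
    (Prod.snd ⁻¹' Set.Iic p.2)).map fun q => (q.1, p.2 - q.2) := rfl
  rw [this, lintegral_map hf (by fun_prop), jumpKernel_apply]

end JumpKernel


/-! ### Conditional laws -/

section CondLaw

variable {Ω F G : Type*} [MeasurableSpace F] [MeasurableSpace G]
  {m mΩ : MeasurableSpace Ω} {μ : Measure Ω} [IsFiniteMeasure μ] {Z : Ω → F} {κ : Ω → Measure F}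

/-- `HasCondLaw` prescribes the joint law of `W` and `Z` on rectangles, which determines it. A
quantity `W` known to `m` can thus be frozen while `Z` is integrated out. -/
theorem HasCondLaw.lintegral_eq (h : HasCondLaw μ m Z κ) (hm : m ≤ mΩ) (hZ : Measurable Z)
    (hκ : ∀ ω, κ ω Set.univ ≤ 1) {W : Ω → G} (hW : Measurable[m] W) {Φ : G × F → ℝ≥0∞}
    (hΦ : Measurable Φ) :
    ∫⁻ ω, Φ (W ω, Z ω) ∂μ = ∫⁻ ω, ∫⁻ z, Φ (W ω, z) ∂κ ω ∂μ := by
  have hW' : Measurable W := hW.mono hm le_rfl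
  let η : Kernel Ω F := ⟨κ, Measure.measurable_of_measurable_coe _ fun B hB =>
    (h.measurable B hB).mono hm le_rfl⟩
  have hη : IsFiniteKernel η := ⟨1, ENNReal.one_lt_top, hκ⟩
  have hWZ : Measurable fun p : Ω × F => (W p.1, p.2) := by fun_prop
  have key : μ.map (fun ω => (W ω, Z ω)) = (μ ⊗ₘ η).map fun p => (W p.1, p.2) := by
    refine Measure.ext_prod fun {C B} hC hB => ?_
    have hpre : (fun p : Ω × F => (W p.1, p.2)) ⁻¹' C ×ˢ B = (W ⁻¹' C) ×ˢ B := rfl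
    rw [Measure.map_apply (by fun_prop) (hC.prod hB), Measure.map_apply hWZ (hC.prod hB), hpre,
      Measure.compProd_apply_prod (hW' hC) hB]
    exact h.setLIntegral_eq _ (hW hC) B hB
  rw [← lintegral_map (μ := μ) hΦ (g := fun ω => (W ω, Z ω)) (by fun_prop), key,
    lintegral_map hΦ hWZ]
  exact Measure.lintegral_compProd (hΦ.comp hWZ)

/-- The integral of `κ univ ≤ 1` is `μ univ`, which forces equality almost everywhere. Applied to
`jumpMeasure`, it shows that the jump laws in a switching construction have no defect of mass. -/
theorem HasCondLaw.ae_univ_eq_one (h : HasCondLaw μ m Z κ) (hm : m ≤ mΩ)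
    (hκ : ∀ ω, κ ω Set.univ ≤ 1) : ∀ᵐ ω ∂μ, κ ω Set.univ = 1 := by
  have h1 := h.setLIntegral_eq Set.univ MeasurableSet.univ Set.univ MeasurableSet.univ
  rw [Set.univ_inter, Set.preimage_univ, setLIntegral_univ] at h1
  have hmeas : Measurable fun ω => κ ω Set.univ :=
    (h.measurable _ .univ).mono hm le_rfl
  refine ae_eq_of_ae_le_of_lintegral_le (.of_forall hκ) (by rw [← h1]; finiteness)
    aemeasurable_const ?_
  rw [lintegral_one, h1]

end CondLaw

section Past

variable {Ω E : Type*} [MeasurableSpace E] {X : ℝ≥0 → Ω → E}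

theorem measurable_past {u s : ℝ≥0} (h : u ≤ s) : Measurable[past X s] (X u) :=
  Measurable.mono (comap_measurable (X u))
    (le_iSup₂_of_le (f := fun v (_ : v ≤ s) => MeasurableSpace.comap (X v) inferInstance)
      u h le_rfl) le_rfl

theorem past_mono {s t : ℝ≥0} (h : s ≤ t) : past X s ≤ past X t :=
  iSup₂_le fun _ hu => (measurable_past (X := X) (hu.trans h)).comap_le

theorem past_le {mΩ : MeasurableSpace Ω} (hX : ∀ t, Measurable (X t)) (s : ℝ≥0) :
    past X s ≤ mΩ :=
  iSup₂_le fun u _ => (hX u).comap_le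

end Past

/-! ### Uniqueness of the law of a Markov process on path space -/

section Unique

variable {E : Type*} [TopologicalSpace E] [MeasurableSpace E]

/-- The coordinate process on path space. -/
abbrev coord (t : ℝ≥0) (ζ : CadlagPath E) : E := ζ.1 t

theorem past_coord_le (r : ℝ≥0) :
    past (coord (E := E)) r ≤ (inferInstance : MeasurableSpace (CadlagPath E)) :=
  past_le measurable_eval r

/-- Products of indicators describe the square cylinders, a generating π-system. General test
functions are used so that an induction on the times can absorb a transition integral into a factor.
-/
theorem ext_path {ν ν' : Measure (CadlagPath E)} [IsFiniteMeasure ν]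
    (h : ∀ (J : Finset ℝ≥0) (g : ℝ≥0 → E → ℝ≥0∞), (∀ i, Measurable (g i)) →
      ∫⁻ ζ, ∏ i ∈ J, g i (ζ.1 i) ∂ν = ∫⁻ ζ, ∏ i ∈ J, g i (ζ.1 i) ∂ν') : ν = ν' := by
  have hmap : ν.map Subtype.val = ν'.map Subtype.val := by
    refine ext_of_generate_finite (squareCylinders fun _ => {s : Set E | MeasurableSet s})
      generateFrom_squareCylinders.symm (isPiSystem_squareCylinders
        (fun _ => MeasurableSpace.isPiSystem_measurableSet) fun _ => .univ) ?_ ?_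
    · rintro _ ⟨J, S, hS, rfl⟩
      have hS' (i : ℝ≥0) : MeasurableSet (S i) := hS i (Set.mem_univ i)
      have hm : MeasurableSet ((J : Set ℝ≥0).pi S) :=
        .pi J.countable_toSet fun i _ => hS' i
      rw [Measure.map_apply measurable_subtype_coe hm,
        Measure.map_apply measurable_subtype_coe hm,
        ← lintegral_indicator_one (measurable_subtype_coe hm),
        ← lintegral_indicator_one (measurable_subtype_coe hm)]
      have hind (ζ : CadlagPath E) : (Subtype.val ⁻¹' (J : Set ℝ≥0).pi S).indicator
          (1 : CadlagPath E → ℝ≥0∞) ζ = ∏ i ∈ J, (S i).indicator 1 (ζ.1 i) := by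
        by_cases hζ : ∀ i ∈ J, ζ.1 i ∈ S i
        · rw [Set.indicator_of_mem (by simpa [Set.mem_pi] using hζ),
            Finset.prod_eq_one fun i hi => by simp [hζ i hi]]
          rfl
        · rw [Set.indicator_of_notMem (by simpa [Set.mem_pi] using hζ)]
          push Not at hζ
          obtain ⟨i, hi, hiS⟩ := hζ
          rw [Finset.prod_eq_zero hi (by simp [hiS])]
      simp_rw [hind]
      exact h J _ fun i => measurable_one.indicator (hS' i)
    · rw [Measure.map_apply measurable_subtype_coe .univ,
        Measure.map_apply measurable_subtype_coe .univ]
      simpa using h ∅ (fun _ _ => 1) fun _ => measurable_const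
  ext D hD
  obtain ⟨D', hD', rfl⟩ := hD
  rw [← Measure.map_apply measurable_subtype_coe hD', hmap,
    Measure.map_apply measurable_subtype_coe hD']

/-- Conditioning at the previous time `a` replaces the factor at the latest time `b` by a function
of the position at `a`, leaving fewer times; a single remaining time is brought back to time `0`,
where the laws agree. -/
theorem markov_law_unique {R : ℝ≥0 → Kernel E E} (hR : ∀ t, IsMarkovKernel (R t))
    {ν ν' : Measure (CadlagPath E)} [IsFiniteMeasure ν] [IsFiniteMeasure ν']
    (hν : ∀ t u, HasCondLaw ν (past coord t) (coord (t + u)) fun ζ => R u (ζ.1 t))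
    (hν' : ∀ t u, HasCondLaw ν' (past coord t) (coord (t + u)) fun ζ => R u (ζ.1 t))
    (h0 : ν.map (coord 0) = ν'.map (coord 0)) : ν = ν' := by
  refine ext_path fun J => ?_
  induction J using Finset.induction_on_max with
  | empty =>
    intro g _
    have := congrArg (fun ρ : Measure E => ρ Set.univ) h0
    simp only [Measure.map_apply (measurable_eval 0) .univ, Set.preimage_univ] at this
    simp [this]
  | insert b J hb ih =>
    intro g hg
    have hbJ : b ∉ J := fun h => lt_irrefl _ (hb b h)
    have hstep {a : ℝ≥0} (hab : a ≤ b) {w : CadlagPath E → ℝ≥0∞}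
        (hw : Measurable[past coord a] w) {ρ : Measure (CadlagPath E)} [IsFiniteMeasure ρ]
        (hρ : ∀ t u, HasCondLaw ρ (past coord t) (coord (t + u)) fun ζ => R u (ζ.1 t)) :
        ∫⁻ ζ, w ζ * g b (ζ.1 b) ∂ρ =
          ∫⁻ ζ, w ζ * ∫⁻ y, g b y ∂(R (b - a) (ζ.1 a)) ∂ρ := by
      have h := (hρ a (b - a)).lintegral_eq (past_coord_le a) (measurable_eval _)
        (fun ζ => (measure_univ (μ := R (b - a) (ζ.1 a))).le) hw
        (Φ := fun p : ℝ≥0∞ × E => p.1 * g b p.2)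
        (measurable_fst.mul ((hg b).comp measurable_snd))
      simp only [add_tsub_cancel_of_le hab, lintegral_const_mul _ (hg b)] at h
      exact h
    have hk (u : ℝ≥0) : Measurable fun x => ∫⁻ y, g b y ∂(R u x) := (hg b).lintegral_kernel
    simp_rw [Finset.prod_insert hbJ, mul_comm (g b _)]
    rcases J.eq_empty_or_nonempty with rfl | hne
    · have hinit (k : E → ℝ≥0∞) (hk : Measurable k) :
          ∫⁻ ζ, k (ζ.1 0) ∂ν = ∫⁻ ζ, k (ζ.1 0) ∂ν' := by
        have := congrArg (fun ρ : Measure E => ∫⁻ x, k x ∂ρ) h0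
        simpa only [lintegral_map hk (measurable_eval 0)] using this
      simp only [Finset.prod_empty]
      rw [hstep zero_le measurable_const hν, hstep zero_le measurable_const hν']
      simp only [one_mul]
      exact hinit _ (hk _)
    · set a := J.max' hne with ha
      have haJ : a ∈ J := J.max'_mem hne
      have hab : a ≤ b := (hb a haJ).le
      have hw : Measurable[past coord a] fun ζ : CadlagPath E => ∏ i ∈ J, g i (ζ.1 i) :=
        Finset.measurable_fun_prod _ fun i hi =>
          (hg i).comp (measurable_past (X := coord (E := E)) (J.le_max' i hi))
      rw [hstep hab hw hν, hstep hab hw hν']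
      -- The transition integral from `a` to `b` is absorbed into the test function at `a`, so the
      -- induction must run over all `g`.
      have h := ih (Function.update g a fun x => g a x * ∫⁻ y, g b y ∂(R (b - a) x)) fun i => by
        rcases eq_or_ne i a with rfl | hi
        · rw [Function.update_self]
          exact (hg _).mul (hk _)
        · simpa [hi] using hg i
      have hprod (ζ : CadlagPath E) : ∏ i ∈ J,
          Function.update g a (fun x => g a x * ∫⁻ y, g b y ∂(R (b - a) x)) i (ζ.1 i) =
            (∏ i ∈ J, g i (ζ.1 i)) * ∫⁻ y, g b y ∂(R (b - a) (ζ.1 a)) := by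
        rw [← Finset.mul_prod_erase _ _ haJ, ← Finset.mul_prod_erase J (fun i => g i (ζ.1 i)) haJ,
          Finset.prod_congr rfl fun i hi => by
            rw [Function.update_of_ne (Finset.ne_of_mem_erase hi)]]
        simp only [Function.update_self]
        ring
      simpa only [hprod] using h

end Unique

/-! ### The Markov property on path space -/

section MarkovFamily

variable {E : Type*} [TopologicalSpace E] [MeasurableSpace E]

theorem measurable_shift_past (r t : ℝ≥0) :
    Measurable[past (coord (E := E)) (r + t), past coord t] (shift r) := by
  rw [measurable_iff_comap_le]
  simp only [past, MeasurableSpace.comap_iSup, MeasurableSpace.comap_comp]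
  exact iSup₂_le fun u hu => (measurable_past (X := coord (E := E))
    (add_le_add_right hu r)).comap_le

theorem measurable_stop_past (r : ℝ≥0) :
    Measurable[past (coord (E := E)) r] (stopAt r : CadlagPath E → CadlagPath E) :=
  measurable_path_iff.2 fun t => measurable_past (X := coord (E := E)) (min_le_right t r)

variable [BorelSpace E] [TopologicalSpace.PseudoMetrizableSpace E] {law : Kernel E (CadlagPath E)}

/-- Upgrades the Markov property from one future time to the whole future path. For `A` in the past
at `r`, the shifted law restricted to `A` and the mixture of `law (ζ r)` over `A` are Markov for the
same `R` with the same initial law, so `markov_law_unique` identifies them. -/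
theorem IsMarkovFamily.hasCondLaw_shift (hlaw : IsMarkovFamily law) (x : E) (r : ℝ≥0) :
    HasCondLaw (law x) (past coord r) (shift r) fun ζ => law (ζ.1 r) := by
  obtain ⟨R, hR, hmk⟩ := hlaw.markov
  have := hlaw.isMarkovKernel
  have hshift : Measurable (shift r : CadlagPath E → CadlagPath E) :=
    measurable_shift_comp measurable_id measurable_const
  have hle (t : ℝ≥0) := past_coord_le (E := E) t
  have hmk' (y : E) (t u : ℝ≥0) :
    HasCondLaw (law y) (past coord t) (coord (t + u)) fun ζ => R u (ζ.1 t) := (hmk y).condLaw t u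
  let L : Kernel (CadlagPath E) (CadlagPath E) := law.comap (coord r) (measurable_eval r)
  have hL : IsMarkovKernel L := by infer_instance
  refine ⟨fun B hB => (law.measurable_coe hB).comp
    (measurable_past (X := coord (E := E)) le_rfl), fun A hA D hD => ?_⟩
  have hAm := hle r A hA
  have key : ((law x).restrict A).map (shift r) = ((law x).restrict A).bind L := by
    have : IsFiniteMeasure (((law x).restrict A).bind L) := by
      infer_instance
    refine markov_law_unique hR.isMarkovKernel (fun t u => ⟨fun B hB => ?_, fun C hC B hB => ?_⟩)
      (fun t u => ⟨fun B hB => ?_, fun C hC B hB => ?_⟩) ?_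
    · exact ((R u).measurable_coe hB).comp (measurable_past (X := coord (E := E)) le_rfl)
    · have hCm := hle t C hC
      -- As `A` is known at time `r`, it can join the conditioning event at time `r + t`, and the
      -- shifted process inherits the Markov property.
      have hAC : MeasurableSet[past coord (r + t)] (shift r ⁻¹' C ∩ A) :=
        (measurable_shift_past r t hC).inter (past_mono le_self_add A hA)
      have hBm : MeasurableSet (coord (t + u) ⁻¹' B) := measurable_eval _ hB
      have hf : Measurable fun ζ : CadlagPath E => R u (ζ.1 t) B :=
        ((R u).measurable_coe hB).comp (measurable_eval t)
      rw [Measure.map_apply hshift (hCm.inter hBm), setLIntegral_map hCm hf hshift,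
        Measure.restrict_apply (hshift (hCm.inter hBm)), Measure.restrict_restrict (hshift hCm)]
      have h := (hmk' x (r + t) u).setLIntegral_eq _ hAC B hB
      simp only [shift_apply]
      rw [← h]
      congr 1
      ext ζ
      simp only [Set.mem_inter_iff, Set.mem_preimage, coord, shift_apply, add_assoc]
      tauto
    · exact ((R u).measurable_coe hB).comp (measurable_past (X := coord (E := E)) le_rfl)
    · have hCm := hle t C hC
      have hBm : MeasurableSet (coord (t + u) ⁻¹' B) := measurable_eval _ hB
      have hf : Measurable fun ζ : CadlagPath E => R u (ζ.1 t) B :=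
        ((R u).measurable_coe hB).comp (measurable_eval t)
      rw [Measure.bind_apply (hCm.inter hBm) L.aemeasurable, ← lintegral_indicator hCm,
        Measure.lintegral_bind L.aemeasurable (hf.indicator hCm).aemeasurable]
      refine lintegral_congr fun ζ => ?_
      rw [lintegral_indicator hCm]
      exact (hmk' (ζ.1 r) t u).setLIntegral_eq C hC B hB
    · ext B hB
      have h0 (y : E) : law y (coord 0 ⁻¹' B) = B.indicator 1 y := by
        rw [← lintegral_indicator_one (measurable_eval 0 hB)]
        calc ∫⁻ ζ, (coord 0 ⁻¹' B).indicator 1 ζ ∂law y = ∫⁻ ζ, B.indicator 1 y ∂law y := by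
              refine lintegral_congr_ae ?_
              filter_upwards [hlaw.start y] with ζ hζ
              exact congrArg (B.indicator (1 : E → ℝ≥0∞)) hζ
          _ = _ := by simp
      rw [Measure.map_apply (measurable_eval 0) hB, Measure.map_apply (measurable_eval 0) hB,
        Measure.map_apply hshift (measurable_eval 0 hB),
        Measure.bind_apply (measurable_eval 0 hB) L.aemeasurable,
        ← lintegral_indicator_one (hshift (measurable_eval 0 hB))]
      refine lintegral_congr fun ζ => ?_
      have : L ζ (coord 0 ⁻¹' B) = B.indicator 1 (ζ.1 r) := h0 (ζ.1 r)
      rw [this]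
      exact congrArg (B.indicator (1 : E → ℝ≥0∞)) (by simp)
  have h := congrArg (fun ρ : Measure (CadlagPath E) => ρ D) key
  simp only [Measure.map_apply hshift hD, Measure.bind_apply hD L.aemeasurable,
    Measure.restrict_apply (hshift hD)] at h
  rw [Set.inter_comm, h]
  rfl

theorem IsMarkovFamily.lintegral_stop_shift (hlaw : IsMarkovFamily law) (x : E) (r : ℝ≥0)
    {Φ : CadlagPath E × CadlagPath E → ℝ≥0∞} (hΦ : Measurable Φ) :
    ∫⁻ ζ, Φ (stopAt r ζ, shift r ζ) ∂law x =
      ∫⁻ ζ, ∫⁻ ζ', Φ (stopAt r ζ, ζ') ∂law (ζ.1 r) ∂law x := by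
  have := hlaw.isMarkovKernel
  have hshift : Measurable (shift r : CadlagPath E → CadlagPath E) :=
    measurable_shift_comp measurable_id measurable_const
  exact (hlaw.hasCondLaw_shift x r).lintegral_eq (past_coord_le r) hshift
    (fun ζ => (measure_univ (μ := law (ζ.1 r))).le) (measurable_stop_past r) hΦ

end MarkovFamily


/-! ### The minimal semigroup -/

section Start

variable {E : Type*} [TopologicalSpace E] [MeasurableSpace E] (law : Kernel E (CadlagPath E))

/-- From a state `x` and a remaining time `t`, draw a path under `law x` and keep `t`. -/
def startKernel : Kernel (E × ℝ≥0) (CadlagPath E × ℝ≥0) := law ∥ₖ Kernel.id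

theorem lintegral_startKernel [IsMarkovKernel law] (x : E) (t : ℝ≥0)
    {f : CadlagPath E × ℝ≥0 → ℝ≥0∞} (hf : Measurable f) :
    ∫⁻ p, f p ∂startKernel law (x, t) = ∫⁻ ζ, f (ζ, t) ∂law x := by
  rw [startKernel, Kernel.lintegral_parallelComp (x, t) hf]
  refine lintegral_congr fun ζ => ?_
  exact Kernel.lintegral_id' (hf.comp measurable_prodMk_left) t

end Start

section Minimal

variable {E : Type*} [TopologicalSpace E] [MeasurableSpace E] [BorelSpace E]
  [TopologicalSpace.PseudoMetrizableSpace E] (law : Kernel E (CadlagPath E)) {rate : E → ℝ≥0}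
  (hrate : Measurable rate) (Q : Kernel E E) [IsMarkovKernel Q]

/-- `jumpCount n (x, t)` is the law of the position at time `t`, from the initial state `x`, on the
event that there are exactly `n` jumps before `t`. -/
def jumpCount : ℕ → Kernel (E × ℝ≥0) E
  | 0 => stayKernel hrate ∘ₖ startKernel law
  | n + 1 => jumpCount n ∘ₖ jumpBeforeKernel hrate Q ∘ₖ startKernel law

/-- The analogue of `jumpCount` when the path followed until the first jump is given. -/
def jumpCountPath : ℕ → Kernel (CadlagPath E × ℝ≥0) E
  | 0 => stayKernel hrate
  | n + 1 => jumpCount law hrate Q n ∘ₖ jumpBeforeKernel hrate Q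

theorem lintegral_jumpCountPath_zero (ζ : CadlagPath E) (t : ℝ≥0) {f : E → ℝ≥0∞}
    (hf : Measurable f) :
    ∫⁻ y, f y ∂jumpCountPath law hrate Q 0 (ζ, t) = survival rate ζ.1 t * f (ζ.1 t) :=
  lintegral_stayKernel hrate (ζ, t) hf

theorem lintegral_jumpCountPath_succ (n : ℕ) (ζ : CadlagPath E) (t : ℝ≥0) {f : E → ℝ≥0∞}
    (hf : Measurable f) :
    ∫⁻ y, f y ∂jumpCountPath law hrate Q (n + 1) (ζ, t) =
      ∫⁻ q in Prod.snd ⁻¹' Set.Iic t, ∫⁻ y, f y ∂jumpCount law hrate Q n (q.1, t - q.2)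
        ∂jumpMeasure rate Q ζ.1 := by
  rw [jumpCountPath, Kernel.lintegral_comp _ _ _ hf,
    lintegral_jumpBeforeKernel hrate Q _ hf.lintegral_kernel]

theorem lintegral_jumpCount [IsMarkovKernel law] (n : ℕ) (x : E) (t : ℝ≥0) {f : E → ℝ≥0∞}
    (hf : Measurable f) :
    ∫⁻ y, f y ∂jumpCount law hrate Q n (x, t) =
      ∫⁻ ζ, ∫⁻ y, f y ∂jumpCountPath law hrate Q n (ζ, t) ∂law x := by
  have h : jumpCount law hrate Q n = jumpCountPath law hrate Q n ∘ₖ startKernel law := by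
    cases n with
    | zero => rfl
    | succ n => rw [jumpCount, jumpCountPath, Kernel.comp_assoc]
  rw [h, Kernel.lintegral_comp _ _ _ hf, lintegral_startKernel law x t hf.lintegral_kernel]

variable {law}

/-- Markov property at time `r`, with an arbitrary weight depending on the path before `r`. -/
theorem IsMarkovFamily.lintegral_stop_mul_jumpCountPath (hlaw : IsMarkovFamily law) (x : E)
    (r t : ℝ≥0) (n : ℕ) {h : CadlagPath E → ℝ≥0∞} (hh : Measurable h) {f : E → ℝ≥0∞}
    (hf : Measurable f) :
    ∫⁻ ζ, h (stopAt r ζ) * ∫⁻ y, f y ∂jumpCountPath law hrate Q n (shift r ζ, t) ∂law x =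
      ∫⁻ ζ, h (stopAt r ζ) * ∫⁻ y, f y ∂jumpCount law hrate Q n (ζ.1 r, t) ∂law x := by
  have := hlaw.isMarkovKernel
  have hm : Measurable fun ζ : CadlagPath E =>
      ∫⁻ y, f y ∂jumpCountPath law hrate Q n (ζ, t) :=
    hf.lintegral_kernel.comp (measurable_id.prodMk measurable_const)
  rw [hlaw.lintegral_stop_shift x r
    (Φ := fun p => h p.1 * ∫⁻ y, f y ∂jumpCountPath law hrate Q n (p.2, t))
    ((hh.comp measurable_fst).mul (hm.comp measurable_snd))]
  refine lintegral_congr fun ζ => ?_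
  simp only
  rw [lintegral_const_mul _ hm, lintegral_jumpCount law hrate Q n _ t hf]

/-- The weight is a function of the path stopped at `s`, so the Markov property turns a jump-free
stretch up to `s`, followed by `n` jumps, into a composition of kernels. -/
theorem IsMarkovFamily.lintegral_survival_mul_jumpCountPath (hlaw : IsMarkovFamily law) (x : E)
    (s t : ℝ≥0) (n : ℕ) {f : E → ℝ≥0∞} (hf : Measurable f) :
    ∫⁻ ζ, survival rate ζ.1 s * ∫⁻ y, f y ∂jumpCountPath law hrate Q n (shift s ζ, t) ∂law x =
      ∫⁻ y, ∫⁻ z, f z ∂jumpCount law hrate Q n (y, t) ∂jumpCount law hrate Q 0 (x, s) := by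
  have := hlaw.isMarkovKernel
  have h := hlaw.lintegral_stop_mul_jumpCountPath hrate Q x s t n
    (h := fun ζ => survival rate ζ.1 s)
    (measurable_survival_comp hrate measurable_id measurable_const) hf
  simp only [survival_stop] at h
  have hg : Measurable fun y => ∫⁻ z, f z ∂jumpCount law hrate Q n (y, t) :=
    hf.lintegral_kernel.comp (measurable_id.prodMk measurable_const)
  rw [h, lintegral_jumpCount law hrate Q 0 x s hg]
  exact lintegral_congr fun ζ => (lintegral_jumpCountPath_zero law hrate Q ζ s hg).symm

/-- Chapman–Kolmogorov with `i` jumps before `s` and `j` after. If the first jump comes after `s`,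
the shifted path restarts under `law (ζ s)`; if it comes at `v ≤ s`, the induction hypothesis
applies from the new position, with `s - v` in place of `s`. -/
theorem IsMarkovFamily.lintegral_jumpCount_add (hlaw : IsMarkovFamily law) (n : ℕ) (x : E)
    (s t : ℝ≥0) {f : E → ℝ≥0∞} (hf : Measurable f) :
    ∫⁻ y, f y ∂jumpCount law hrate Q n (x, s + t) =
      ∑ ij ∈ Finset.HasAntidiagonal.antidiagonal n, ∫⁻ y, ∫⁻ z, f z ∂jumpCount law hrate Q ij.2 (y, t)
        ∂jumpCount law hrate Q ij.1 (x, s) := by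
  have := hlaw.isMarkovKernel
  have hg (j : ℕ) : Measurable fun y => ∫⁻ z, f z ∂jumpCount law hrate Q j (y, t) :=
    hf.lintegral_kernel.comp (measurable_id.prodMk measurable_const)
  induction n generalizing x s with
  | zero =>
    rw [Finset.Nat.antidiagonal_zero, Finset.sum_singleton,
      ← hlaw.lintegral_survival_mul_jumpCountPath hrate Q x s t 0 hf,
      lintegral_jumpCount law hrate Q 0 x _ hf]
    refine lintegral_congr fun ζ => ?_
    rw [lintegral_jumpCountPath_zero law hrate Q _ _ hf,
      lintegral_jumpCountPath_zero law hrate Q _ _ hf, survival_add, mul_assoc]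
    rfl
  | succ n ih =>
    rw [Finset.Nat.sum_antidiagonal_succ,
      ← hlaw.lintegral_survival_mul_jumpCountPath hrate Q x s t (n + 1) hf,
      lintegral_jumpCount law hrate Q (n + 1) x _ hf]
    have hsplit (ζ : CadlagPath E) :
        ∫⁻ y, f y ∂jumpCountPath law hrate Q (n + 1) (ζ, s + t) =
          survival rate ζ.1 s *
              ∫⁻ y, f y ∂jumpCountPath law hrate Q (n + 1) (shift s ζ, t) +
            ∑ ij ∈ Finset.HasAntidiagonal.antidiagonal n,
              ∫⁻ y, ∫⁻ z, f z ∂jumpCount law hrate Q ij.2 (y, t)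
                ∂jumpCountPath law hrate Q (ij.1 + 1) (ζ, s) := by
      have hF : Measurable fun q : E × ℝ≥0 => ∫⁻ y, f y ∂jumpCount law hrate Q n q :=
        hf.lintegral_kernel
      have hset : Set.Iic (s + t) = Set.Ioc s (s + t) ∪ Set.Iic s := by
        rw [Set.union_comm, Set.Iic_union_Ioc_eq_Iic (by simp)]
      rw [lintegral_jumpCountPath_succ law hrate Q n _ _ hf, hset, Set.preimage_union,
        lintegral_union (measurable_snd measurableSet_Iic)
          ((Set.Iic_disjoint_Ioc le_rfl).symm.preimage _),
        setLIntegral_jumpMeasure_Ioc Q hrate (measurable_path ζ) hF,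
        lintegral_jumpCountPath_succ law hrate Q n _ _ hf]
      congr 1
      simp_rw [lintegral_jumpCountPath_succ law hrate Q _ _ _ (hg _)]
      rw [← lintegral_finsetSum]
      · refine setLIntegral_congr_fun (measurable_snd measurableSet_Iic) fun q hq => ?_
        have hq' : q.2 ≤ s := hq
        -- Subtraction is truncated: the remaining time `s + t - q.2` splits as `(s - q.2) + t` only
        -- because the first jump precedes `s`.
        rw [← ih, tsub_add_eq_add_tsub hq']
      · intro ij _
        exact (hg ij.2).lintegral_kernel.comp (by fun_prop)
    simp_rw [hsplit]
    have hm (i : ℕ) {g : E → ℝ≥0∞} (hg : Measurable g) : Measurable fun ζ : CadlagPath E =>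
        ∫⁻ y, g y ∂jumpCountPath law hrate Q i (ζ, s) :=
      hg.lintegral_kernel.comp (measurable_id.prodMk measurable_const)
    rw [lintegral_add_right, lintegral_finsetSum]
    · congr 1
      exact Finset.sum_congr rfl fun ij _ => (lintegral_jumpCount law hrate Q _ x s (hg _)).symm
    · exact fun ij _ => hm _ (hg _)
    · exact Finset.measurable_fun_sum _ fun ij _ => hm _ (hg _)

variable (law)

/-- The minimal transition kernel, from a state and a time: the law of the position at that time
on the event that the jumps before it are finitely many. -/
def minimalKernel : Kernel (E × ℝ≥0) E := Kernel.sum (jumpCount law hrate Q)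

theorem lintegral_minimalKernel (p : E × ℝ≥0) (f : E → ℝ≥0∞) :
    ∫⁻ y, f y ∂minimalKernel law hrate Q p = ∑' n, ∫⁻ y, f y ∂jumpCount law hrate Q n p := by
  rw [minimalKernel, Kernel.sum_apply, lintegral_sum_measure]

/-- The analogue of `minimalKernel` when the path followed until the first jump is given. -/
def minimalKernelPath : Kernel (CadlagPath E × ℝ≥0) E := Kernel.sum (jumpCountPath law hrate Q)

theorem lintegral_minimalKernelPath (p : CadlagPath E × ℝ≥0) (f : E → ℝ≥0∞) :
    ∫⁻ y, f y ∂minimalKernelPath law hrate Q p =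
      ∑' n, ∫⁻ y, f y ∂jumpCountPath law hrate Q n p := by
  rw [minimalKernelPath, Kernel.sum_apply, lintegral_sum_measure]

/-- The renewal equation at the first jump: the zeroth term of the sum is separated and the others
regrouped. -/
theorem lintegral_minimalKernelPath_eq (ζ : CadlagPath E) (t : ℝ≥0) {f : E → ℝ≥0∞}
    (hf : Measurable f) :
    ∫⁻ y, f y ∂minimalKernelPath law hrate Q (ζ, t) =
      survival rate ζ.1 t * f (ζ.1 t) +
        ∫⁻ q in Prod.snd ⁻¹' Set.Iic t, ∫⁻ y, f y ∂minimalKernel law hrate Q (q.1, t - q.2)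
          ∂jumpMeasure rate Q ζ.1 := by
  rw [lintegral_minimalKernelPath, tsum_eq_zero_add' ENNReal.summable,
    lintegral_jumpCountPath_zero law hrate Q ζ t hf]
  simp_rw [lintegral_jumpCountPath_succ law hrate Q _ ζ t hf, lintegral_minimalKernel]
  rw [lintegral_tsum]
  exact fun n => (hf.lintegral_kernel.comp (by fun_prop)).aemeasurable

/-- Induction on the number of terms: after the first jump one term fewer is left, of mass at most
one by induction, and staying and jumping together have mass at most one. -/
theorem minimalKernel_univ_le [IsMarkovKernel law] (p : E × ℝ≥0) :
    minimalKernel law hrate Q p Set.univ ≤ 1 := by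
  have hpart (N : ℕ) (x : E) (t : ℝ≥0) :
      ∑ i ∈ Finset.range N, ∫⁻ _, 1 ∂jumpCount law hrate Q i (x, t) ≤ 1 := by
    induction N generalizing x t with
    | zero => simp
    | succ N ih =>
      simp_rw [lintegral_jumpCount law hrate Q _ x t measurable_const]
      have hm (i : ℕ) : Measurable fun ζ : CadlagPath E =>
          ∫⁻ _, 1 ∂jumpCountPath law hrate Q i (ζ, t) :=
        (Measurable.lintegral_kernel (κ := jumpCountPath law hrate Q i) measurable_const).comp
          (measurable_id.prodMk measurable_const)
      have hm' (i : ℕ) : Measurable fun q : E × ℝ≥0 =>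
          ∫⁻ _, 1 ∂jumpCount law hrate Q i (q.1, t - q.2) :=
        (Measurable.lintegral_kernel (κ := jumpCount law hrate Q i) measurable_const).comp
          (by fun_prop)
      rw [← lintegral_finsetSum _ fun i _ => hm i]
      refine (lintegral_mono (g := fun _ => 1) fun ζ => ?_).trans (by simp)
      rw [Finset.sum_range_succ', lintegral_jumpCountPath_zero law hrate Q _ _ measurable_const]
      simp_rw [lintegral_jumpCountPath_succ law hrate Q _ _ _ measurable_const]
      rw [← lintegral_finsetSum _ fun i _ => hm' i]
      refine le_trans ?_ (jumpMeasure_Iic_add_survival_le Q hrate (measurable_path ζ) t)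
      rw [mul_one]
      gcongr
      refine (setLIntegral_mono (g := fun _ => 1) measurable_const fun q _ => ih _ _).trans ?_
      rw [setLIntegral_one]
  rw [← lintegral_one, lintegral_minimalKernel, ENNReal.tsum_eq_iSup_nat]
  exact iSup_le fun N => hpart N p.1 p.2

variable {law}

/-- Markov property at time `r`, with an arbitrary weight depending on the path before `r`. -/
theorem IsMarkovFamily.lintegral_stop_mul_minimalKernelPath (hlaw : IsMarkovFamily law) (x : E)
    (r t : ℝ≥0) {h : CadlagPath E → ℝ≥0∞} (hh : Measurable h) {f : E → ℝ≥0∞}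
    (hf : Measurable f) :
    ∫⁻ ζ, h (stopAt r ζ) * ∫⁻ y, f y ∂minimalKernelPath law hrate Q (shift r ζ, t) ∂law x =
      ∫⁻ ζ, h (stopAt r ζ) * ∫⁻ y, f y ∂minimalKernel law hrate Q (ζ.1 r, t) ∂law x := by
  have hst : Measurable fun ζ : CadlagPath E => h (stopAt r ζ) :=
    hh.comp (measurable_stop_comp measurable_id measurable_const)
  simp_rw [lintegral_minimalKernelPath, lintegral_minimalKernel, ← ENNReal.tsum_mul_left]
  rw [lintegral_tsum, lintegral_tsum]
  · exact tsum_congr fun n => hlaw.lintegral_stop_mul_jumpCountPath hrate Q x r t n hh hf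
  · exact fun n => (hst.mul (hf.lintegral_kernel.comp
      ((measurable_eval r).prodMk measurable_const))).aemeasurable
  · exact fun n => (hst.mul (hf.lintegral_kernel.comp
      ((measurable_shift_comp measurable_id measurable_const).prodMk
        measurable_const))).aemeasurable

/-- The antidiagonals of `lintegral_jumpCount_add` sweep out all pairs of jump counts. -/
theorem IsMarkovFamily.lintegral_minimalKernel_add (hlaw : IsMarkovFamily law) (x : E)
    (s t : ℝ≥0) {f : E → ℝ≥0∞} (hf : Measurable f) :
    ∫⁻ y, f y ∂minimalKernel law hrate Q (x, s + t) =
      ∫⁻ y, ∫⁻ z, f z ∂minimalKernel law hrate Q (y, t) ∂minimalKernel law hrate Q (x, s) := by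
  have hg (j : ℕ) : Measurable fun y => ∫⁻ z, f z ∂jumpCount law hrate Q j (y, t) :=
    hf.lintegral_kernel.comp (measurable_id.prodMk measurable_const)
  simp_rw [lintegral_minimalKernel, hlaw.lintegral_jumpCount_add hrate Q _ x s t hf,
    lintegral_tsum fun j => (hg j).aemeasurable]
  rw [← ENNReal.tsum_prod (f := fun i j => ∫⁻ y, ∫⁻ z, f z ∂jumpCount law hrate Q j (y, t)
    ∂jumpCount law hrate Q i (x, s)), ← Finset.HasAntidiagonal.sigmaAntidiagonalEquivProd.tsum_eq,
    ENNReal.tsum_sigma']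
  refine tsum_congr fun n => ?_
  rw [tsum_fintype, Finset.univ_eq_attach, ← Finset.sum_attach]
  rfl

theorem IsMarkovFamily.minimalKernel_add (hlaw : IsMarkovFamily law) (x : E)
    (s t : ℝ≥0) {B : Set E} (hB : MeasurableSet B) :
    minimalKernel law hrate Q (x, s + t) B =
      ∫⁻ y, minimalKernel law hrate Q (y, t) B ∂minimalKernel law hrate Q (x, s) := by
  have h := hlaw.lintegral_minimalKernel_add hrate Q x s t (measurable_one.indicator hB)
  simpa only [lintegral_indicator_one hB] using h

theorem IsMarkovFamily.minimalKernel_zero (hlaw : IsMarkovFamily law) (x : E) :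
    minimalKernel law hrate Q (x, 0) = Measure.dirac x := by
  have := hlaw.isMarkovKernel
  ext B hB
  have hf : Measurable (B.indicator (1 : E → ℝ≥0∞)) := measurable_one.indicator hB
  rw [← lintegral_indicator_one hB, lintegral_minimalKernel, tsum_eq_single 0,
    lintegral_jumpCount law hrate Q 0 x 0 hf, Measure.dirac_apply' _ hB]
  · calc ∫⁻ ζ, ∫⁻ y, B.indicator 1 y ∂jumpCountPath law hrate Q 0 (ζ, 0) ∂law x
        = ∫⁻ ζ, B.indicator 1 x ∂law x := by
          refine lintegral_congr_ae ?_
          filter_upwards [hlaw.start x] with ζ hζ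
          rw [lintegral_jumpCountPath_zero law hrate Q _ _ hf, survival_zero, one_mul, hζ]
      _ = B.indicator 1 x := by simp
  · intro n hn
    obtain ⟨k, rfl⟩ := Nat.exists_eq_succ_of_ne_zero hn
    rw [lintegral_jumpCount law hrate Q _ x 0 hf]
    refine (lintegral_congr fun ζ => ?_).trans lintegral_zero
    rw [lintegral_jumpCountPath_succ law hrate Q _ _ _ hf]
    refine setLIntegral_measure_zero _ _ ?_
    rw [jumpMeasure_snd Q hrate (measurable_path ζ) measurableSet_Iic]
    exact setLIntegral_measure_zero _ _ (by simpa using lebesgue_Iic 0)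

/-! ### The transition function -/

variable (law)

/-- The states from which the jump times almost surely do not accumulate. -/
def nonexplosive : Set E := {x | ∀ n : ℕ, minimalKernel law hrate Q (x, n) Set.univ = 1}

theorem measurableSet_nonexplosive : MeasurableSet (nonexplosive law hrate Q) := by
  have : nonexplosive law hrate Q =
      ⋂ n : ℕ, {x | minimalKernel law hrate Q (x, n) Set.univ = 1} := by
    ext; simp [nonexplosive]
  rw [this]
  refine .iInter fun n => measurableSet_eq_fun ?_ measurable_const
  exact ((minimalKernel law hrate Q).measurable_coe .univ).comp
    (measurable_id.prodMk measurable_const)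

open Classical in
/-- The minimal semigroup at nonexplosive states, completed by keeping the other states fixed. -/
def transition (t : ℝ≥0) : Kernel E E :=
  Kernel.piecewise (measurableSet_nonexplosive law hrate Q)
    ((minimalKernel law hrate Q).comap (fun x => (x, t)) (by fun_prop)) Kernel.id

theorem transition_of_mem {x : E} (hx : x ∈ nonexplosive law hrate Q) (t : ℝ≥0) :
    transition law hrate Q t x = minimalKernel law hrate Q (x, t) :=
  if_pos hx

theorem transition_of_notMem {x : E} (hx : x ∉ nonexplosive law hrate Q) (t : ℝ≥0) :
    transition law hrate Q t x = Measure.dirac x :=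
  (if_neg hx).trans (Kernel.id_apply x)

variable {law}

/-- The mass is nonincreasing in time, by Chapman–Kolmogorov and sub-Markovianity, so integer times
control all times. -/
theorem IsMarkovFamily.minimalKernel_univ_of_mem (hlaw : IsMarkovFamily law) {x : E}
    (hx : x ∈ nonexplosive law hrate Q) (t : ℝ≥0) :
    minimalKernel law hrate Q (x, t) Set.univ = 1 := by
  have := hlaw.isMarkovKernel
  refine le_antisymm (minimalKernel_univ_le law hrate Q _) ?_
  obtain ⟨n, hn⟩ := exists_nat_ge t
  rw [← hx n, ← add_tsub_cancel_of_le hn, hlaw.minimalKernel_add hrate Q x t _ .univ]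
  exact (lintegral_mono fun y => minimalKernel_univ_le law hrate Q _).trans (by simp)

/-- Mass one at `t + n` is the average, over a probability at time `t`, of masses at most one;
almost all of these equal one. -/
theorem IsMarkovFamily.ae_mem_nonexplosive (hlaw : IsMarkovFamily law) {x : E}
    (hx : x ∈ nonexplosive law hrate Q) (t : ℝ≥0) :
    ∀ᵐ y ∂minimalKernel law hrate Q (x, t), y ∈ nonexplosive law hrate Q := by
  have := hlaw.isMarkovKernel
  refine ae_all_iff.2 fun n => ?_
  have h := hlaw.minimalKernel_add hrate Q x t n .univ
  rw [hlaw.minimalKernel_univ_of_mem hrate Q hx] at h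
  refine ae_eq_of_ae_le_of_lintegral_le
    (.of_forall fun y => minimalKernel_univ_le law hrate Q _) (by rw [← h]; finiteness)
    aemeasurable_const ?_
  rw [lintegral_one, ← h, hlaw.minimalKernel_univ_of_mem hrate Q hx]

/-- The minimal semigroup almost surely does not leave the nonexplosive states and the other states
are fixed, so the two regimes do not mix. -/
theorem IsMarkovFamily.isTransitionFunction (hlaw : IsMarkovFamily law) :
    IsTransitionFunction (transition law hrate Q) where
  isMarkovKernel t := ⟨fun x => ⟨by
    by_cases hx : x ∈ nonexplosive law hrate Q
    · rw [transition_of_mem law hrate Q hx, hlaw.minimalKernel_univ_of_mem hrate Q hx]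
    · rw [transition_of_notMem law hrate Q hx, measure_univ]⟩⟩
  zero := by
    ext1 x
    rw [Kernel.id_apply]
    by_cases hx : x ∈ nonexplosive law hrate Q
    · rw [transition_of_mem law hrate Q hx, hlaw.minimalKernel_zero hrate Q]
    · rw [transition_of_notMem law hrate Q hx]
  add s t := by
    ext x B hB
    rw [Kernel.comp_apply' _ _ _ hB]
    by_cases hx : x ∈ nonexplosive law hrate Q
    · rw [transition_of_mem law hrate Q hx, transition_of_mem law hrate Q hx,
        hlaw.minimalKernel_add hrate Q x s t hB]
      refine lintegral_congr_ae ?_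
      filter_upwards [hlaw.ae_mem_nonexplosive hrate Q hx s] with y hy
      rw [transition_of_mem law hrate Q hy]
    · rw [transition_of_notMem law hrate Q hx, transition_of_notMem law hrate Q hx,
        lintegral_dirac' _ (Kernel.measurable_coe _ hB), transition_of_notMem law hrate Q hx]

end Minimal


/-! ### Switching processes -/

section Construction

variable {E : Type*} [TopologicalSpace E] [MeasurableSpace E] {Ω : Type*}
  {ζ : ℕ → Ω → CadlagPath E} {Y : ℕ → Ω → E} {T : ℕ → Ω → ℝ≥0}

theorem measurable_history_path {i k : ℕ} (h : i < k) (n : ℕ) :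
    Measurable[history ζ Y T k n] (ζ i) :=
  Measurable.mono (comap_measurable (ζ i)) ((le_iSup₂_of_le
    (f := fun i (_ : i < k) => MeasurableSpace.comap (ζ i) inferInstance) i h le_rfl).trans
      le_sup_left) le_rfl

theorem measurable_history_pair {j n : ℕ} (h : j ≤ n) (k : ℕ) :
    Measurable[history ζ Y T k n] fun ω => (Y j ω, T j ω) :=
  Measurable.mono (comap_measurable fun ω => (Y j ω, T j ω)) ((le_iSup₂_of_le
    (f := fun j (_ : j ≤ n) => MeasurableSpace.comap (fun ω => (Y j ω, T j ω)) inferInstance)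
      j h le_rfl).trans le_sup_right) le_rfl

theorem measurable_history_time {j n : ℕ} (h : j ≤ n) (k : ℕ) :
    Measurable[history ζ Y T k n] (T j) :=
  measurable_snd.comp (measurable_history_pair (ζ := ζ) (Y := Y) (T := T) h k)

theorem history_mono {k k' n n' : ℕ} (hk : k ≤ k') (hn : n ≤ n') :
    history ζ Y T k n ≤ history ζ Y T k' n' :=
  sup_le
    (iSup₂_le fun _ hi => (measurable_history_path (ζ := ζ) (Y := Y) (T := T)
      (hi.trans_le hk) n').comap_le)
    (iSup₂_le fun _ hj => (measurable_history_pair (ζ := ζ) (Y := Y) (T := T)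
      (hj.trans hn) k').comap_le)

/-- The paths `ζ 0, …, ζ (n - 1)` and the times `T 0, …, T n`, as one variable. -/
def record (x₀ : E) (ζ : ℕ → Ω → CadlagPath E) (T : ℕ → Ω → ℝ≥0) (n : ℕ) (ω : Ω) :
    (ℕ → CadlagPath E) × (ℕ → ℝ≥0) :=
  -- The padding beyond `n` gives records of all lengths one type while keeping them measurable for
  -- `history ζ Y T n n`.
  (fun i => if i < n then ζ i ω else constPath x₀, fun j => T (min j n) ω)

theorem measurable_record (x₀ : E) (n : ℕ) :
    Measurable[history ζ Y T n n] (record x₀ ζ T n) := by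
  refine Measurable.prodMk (@measurable_pi_lambda _ _ _ (history ζ Y T n n) _ _ fun i => ?_)
    (@measurable_pi_lambda _ _ _ (history ζ Y T n n) _ _ fun j =>
      measurable_history_time (min_le_right _ _) n)
  by_cases hi : i < n
  · simpa only [hi, if_true] using measurable_history_path hi n
  · simpa only [hi, if_false] using measurable_const

/-- The value at time `u < T n` of the process built from the first `n` paths and times. -/
def replay (x₀ : E) : ℕ → ℝ≥0 → (ℕ → CadlagPath E) × (ℕ → ℝ≥0) → E
  | 0, _, _ => x₀
  | n + 1, u, w => if w.2 n ≤ u then (w.1 n).1 (u - w.2 n) else replay x₀ n u w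

section Measurable

variable [BorelSpace E] [TopologicalSpace.PseudoMetrizableSpace E]

theorem measurable_replay (x₀ : E) (n : ℕ) (u : ℝ≥0) : Measurable (replay x₀ n u) := by
  induction n with
  | zero => exact measurable_const
  | succ n ih =>
    exact Measurable.ite (measurableSet_le (by fun_prop) measurable_const)
      (measurable_eval_comp (by fun_prop) (by fun_prop)) ih

end Measurable

variable {mΩ : MeasurableSpace Ω} {law : Kernel E (CadlagPath E)} {rate : E → ℝ≥0}
  {Q : Kernel E E} {x₀ : E} {μ : Measure Ω} {X : ℝ≥0 → Ω → E}

namespace IsSwitchingConstruction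

theorem history_le (h : IsSwitchingConstruction law rate Q x₀ μ X ζ Y T) (k n : ℕ) :
    history ζ Y T k n ≤ mΩ :=
  sup_le (iSup₂_le fun i _ => (h.measurable_path i).comap_le)
    (iSup₂_le fun j _ => ((h.measurable_position j).prodMk (h.measurable_time j)).comap_le)

theorem monotone_time (h : IsSwitchingConstruction law rate Q x₀ μ X ζ Y T) (ω : Ω) :
    Monotone fun n => T n ω :=
  monotone_nat_of_le_succ fun n => h.time_le n ω

/-- Non-accumulation enters here: each `t ≥ T n` lies in exactly one interval `[T (n + k), T (n + k
+ 1))`. Coinciding jump times only give empty intervals. -/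
theorem tsum_between_jumps (h : IsSwitchingConstruction law rate Q x₀ μ X ζ Y T) :
    ∀ᵐ ω ∂μ, ∀ (n : ℕ) (t : ℝ≥0) (c : ℝ≥0∞),
      ∑' k, (if T (n + k) ω ≤ t ∧ t < T (n + k + 1) ω then c else 0) =
        if T n ω ≤ t then c else 0 := by
  filter_upwards [h.tendsto_time] with ω hω n t c
  have hmono := h.monotone_time ω
  by_cases hT : T n ω ≤ t
  · rw [if_pos hT]
    have hex : ∃ k, t < T (n + k + 1) ω := by
      obtain ⟨m, hm⟩ := (hω.eventually_gt_atTop t).exists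
      exact ⟨m, hm.trans_le (hmono (by omega))⟩
    classical
    set k := Nat.find hex with hk
    have hkT : T (n + k) ω ≤ t := by
      rcases Nat.eq_zero_or_eq_succ_pred k with h0 | h0
      · rwa [h0]
      · have := Nat.find_min hex (m := k.pred) (by omega)
        rw [h0]
        exact not_lt.1 this
    rw [tsum_eq_single k, if_pos ⟨hkT, Nat.find_spec hex⟩]
    intro j hj
    refine if_neg fun hh => ?_
    rcases lt_or_gt_of_ne hj with hlt | hgt
    · exact Nat.find_min hex hlt hh.2
    · have : t < T (n + j) ω := (Nat.find_spec hex).trans_le (hmono (by omega))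
      exact absurd hh.1 (not_le.2 this)
  · rw [if_neg hT, ENNReal.tsum_eq_zero]
    intro k
    exact if_neg fun hh => hT ((hmono (Nat.le_add_right n k)).trans hh.1)

/-- Leaving `w` free beyond index `n` lets one padded record serve throughout the recursion. -/
theorem eq_replay (h : IsSwitchingConstruction law rate Q x₀ μ X ζ Y T) :
    ∀ᵐ ω ∂μ, ∀ (n : ℕ) (u : ℝ≥0) (w : (ℕ → CadlagPath E) × (ℕ → ℝ≥0)),
      (∀ i < n, w.1 i = ζ i ω ∧ w.2 i = T i ω) → u < T n ω → X u ω = replay x₀ n u w := by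
  filter_upwards [h.process_eq] with ω hω n u w hw hu
  induction n with
  | zero => simp [h.time_zero] at hu
  | succ n ih =>
    obtain ⟨h1, h2⟩ := hw n n.lt_succ_self
    rw [replay, h1, h2]
    split_ifs with hT
    · exact hω n u hT hu
    · exact ih (fun i hi => hw i (hi.trans n.lt_succ_self)) (not_le.1 hT)

theorem lintegral_path [IsFiniteMeasure μ] [IsMarkovKernel law] {G : Type*} [MeasurableSpace G]
    (h : IsSwitchingConstruction law rate Q x₀ μ X ζ Y T) (n : ℕ) {W : Ω → G}
    (hW : Measurable[history ζ Y T n n] W) {Φ : G × CadlagPath E → ℝ≥0∞} (hΦ : Measurable Φ) :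
    ∫⁻ ω, Φ (W ω, ζ n ω) ∂μ = ∫⁻ ω, ∫⁻ z, Φ (W ω, z) ∂law (Y n ω) ∂μ :=
  (h.condLaw_path n).lintegral_eq (h.history_le n n) (h.measurable_path n)
    (fun ω => (measure_univ (μ := law (Y n ω))).le) hW hΦ

/-- Between the jump times `T n` and `T (n + 1)`, an event of the past is described by the record
of the first `n` jumps and by the current path stopped at the present time. -/
theorem exists_set_of_past [BorelSpace E] [TopologicalSpace.PseudoMetrizableSpace E]
    (h : IsSwitchingConstruction law rate Q x₀ μ X ζ Y T) {s : ℝ≥0} (n : ℕ) {A : Set Ω}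
    (hA : MeasurableSet[past X s] A) :
    ∃ D : Set (((ℕ → CadlagPath E) × (ℕ → ℝ≥0)) × CadlagPath E), MeasurableSet D ∧
      ∀ᵐ ω ∂μ, T n ω ≤ s → s < T (n + 1) ω →
        (ω ∈ A ↔ (record x₀ ζ T n ω, stopAt (s - T n ω) (ζ n ω)) ∈ D) := by
  let m : MeasurableSpace Ω :=
    { MeasurableSet' := fun A =>
        ∃ D : Set (((ℕ → CadlagPath E) × (ℕ → ℝ≥0)) × CadlagPath E), MeasurableSet D ∧
          ∀ᵐ ω ∂μ, T n ω ≤ s → s < T (n + 1) ω →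
            (ω ∈ A ↔ (record x₀ ζ T n ω, stopAt (s - T n ω) (ζ n ω)) ∈ D)
      measurableSet_empty := ⟨∅, .empty, by simp⟩
      measurableSet_compl := by
        rintro A ⟨D, hD, hAD⟩
        refine ⟨Dᶜ, hD.compl, ?_⟩
        filter_upwards [hAD] with ω hω h1 h2
        rw [Set.mem_compl_iff, Set.mem_compl_iff, hω h1 h2]
      measurableSet_iUnion := by
        intro A hA
        choose D hD hAD using hA
        refine ⟨⋃ i, D i, .iUnion hD, ?_⟩
        filter_upwards [ae_all_iff.2 hAD] with ω hω h1 h2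
        simp only [Set.mem_iUnion, hω _ h1 h2] }
  have hle : past X s ≤ m := by
    refine iSup₂_le fun u hu => ?_
    rintro _ ⟨C, hC, rfl⟩
    have hmeas : Measurable fun p : ((ℕ → CadlagPath E) × (ℕ → ℝ≥0)) × CadlagPath E =>
        if p.1.2 n ≤ u then p.2.1 (u - p.1.2 n) else replay x₀ n u p.1 :=
      Measurable.ite (measurableSet_le (by fun_prop) measurable_const)
        (measurable_eval_comp (by fun_prop) (by fun_prop))
        ((measurable_replay x₀ n u).comp measurable_fst)
    refine ⟨_, hmeas hC, ?_⟩
    filter_upwards [h.process_eq, h.eq_replay] with ω h1 h2 hs hs'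
    have hX : X u ω = if (record x₀ ζ T n ω).2 n ≤ u then
        (stopAt (s - T n ω) (ζ n ω)).1 (u - (record x₀ ζ T n ω).2 n)
          else replay x₀ n u (record x₀ ζ T n ω) := by
      have hT : (record x₀ ζ T n ω).2 n = T n ω := by simp [record]
      rw [hT]
      split_ifs with hu'
      · rw [h1 n u hu' (hu.trans_lt hs'), stop_apply_of_le (tsub_le_tsub_right hu _)]
      · refine h2 n u _ (fun i hi => ?_) (not_le.1 hu')
        simp [record, hi, min_eq_left hi.le]
    simp only [Set.mem_preimage]
    rw [hX]
  exact hle A hA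

end IsSwitchingConstruction

end Construction

/-! ### Integrating out the next jump -/

section Conditioning

variable {E : Type*} [TopologicalSpace E] [MeasurableSpace E] [BorelSpace E]
  [TopologicalSpace.PseudoMetrizableSpace E] {Ω : Type*}
  {ζ : ℕ → Ω → CadlagPath E} {Y : ℕ → Ω → E} {T : ℕ → Ω → ℝ≥0}
  {mΩ : MeasurableSpace Ω} {law : Kernel E (CadlagPath E)} {rate : E → ℝ≥0}
  {Q : Kernel E E} {x₀ : E} {μ : Measure Ω} {X : ℝ≥0 → Ω → E}

namespace IsSwitchingConstruction

section

variable [IsFiniteMeasure μ] [IsMarkovKernel Q] {G : Type*} [MeasurableSpace G]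

theorem lintegral_jump (hrate : Measurable rate)
    (h : IsSwitchingConstruction law rate Q x₀ μ X ζ Y T) (n : ℕ) {W : Ω → G}
    (hW : Measurable[history ζ Y T (n + 1) n] W) {Φ : G × E × ℝ≥0 → ℝ≥0∞} (hΦ : Measurable Φ) :
    ∫⁻ ω, Φ (W ω, Y (n + 1) ω, T (n + 1) ω - T n ω) ∂μ =
      ∫⁻ ω, ∫⁻ q, Φ (W ω, q) ∂jumpMeasure rate Q (ζ n ω).1 ∂μ :=
  (h.condLaw_jump n).lintegral_eq (h.history_le (n + 1) n)
    ((h.measurable_position _).prodMk ((h.measurable_time _).sub (h.measurable_time _)))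
    (fun ω => jumpMeasure_univ_le Q hrate (Switching.measurable_path (ζ n ω))) hW hΦ

theorem jumpMeasure_Ioi_ae (hrate : Measurable rate)
    (h : IsSwitchingConstruction law rate Q x₀ μ X ζ Y T) (n : ℕ) :
    ∀ᵐ ω ∂μ, ∀ r : ℝ≥0, jumpMeasure rate Q (ζ n ω).1 (Prod.snd ⁻¹' Set.Ioi r) =
      survival rate (ζ n ω).1 r := by
  filter_upwards [(h.condLaw_jump n).ae_univ_eq_one (h.history_le (n + 1) n)
    fun ω => jumpMeasure_univ_le Q hrate (Switching.measurable_path (ζ n ω))] with ω hω r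
  exact jumpMeasure_Ioi Q hrate (Switching.measurable_path (ζ n ω)) hω r

end

end IsSwitchingConstruction

end Conditioning


theorem ite_eq_indicator {α : Type*} {S : Set α} {p : Prop} [Decidable p] {a : α}
    (F : α → ℝ≥0∞) (h : p ↔ a ∈ S) : (if p then F a else 0) = S.indicator F a := by
  by_cases hp : p
  · rw [if_pos hp, Set.indicator_of_mem (h.1 hp)]
  · rw [if_neg hp, Set.indicator_of_notMem (mt h.2 hp)]

/-! ### Restarting at the jump times -/

section Markov

variable {E : Type*} [TopologicalSpace E] [MeasurableSpace E] [BorelSpace E]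
  [TopologicalSpace.PseudoMetrizableSpace E] {Ω : Type*}
  {ζ : ℕ → Ω → CadlagPath E} {Y : ℕ → Ω → E} {T : ℕ → Ω → ℝ≥0}
  {mΩ : MeasurableSpace Ω} {law : Kernel E (CadlagPath E)} {rate : E → ℝ≥0}
  {Q : Kernel E E} {x₀ : E} {μ : Measure Ω} {X : ℝ≥0 → Ω → E}

namespace IsSwitchingConstruction

variable [IsProbabilityMeasure μ] [IsMarkovKernel Q]

theorem lintegral_no_jump (hrate : Measurable rate)
    (h : IsSwitchingConstruction law rate Q x₀ μ X ζ Y T) (n : ℕ) (t : ℝ≥0) {g : Ω → ℝ≥0∞}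
    (hg : Measurable[history ζ Y T (n + 1) n] g) :
    ∫⁻ ω, g ω * (if T n ω ≤ t ∧ t < T (n + 1) ω then 1 else 0) ∂μ =
      ∫⁻ ω, g ω * (if T n ω ≤ t then survival rate (ζ n ω).1 (t - T n ω) else 0) ∂μ := by
  have hm : Measurable fun p : (ℝ≥0∞ × ℝ≥0) × E × ℝ≥0 =>
      p.1.1 * (if p.1.2 ≤ t ∧ t - p.1.2 < p.2.2 then 1 else 0) :=
    (measurable_fst.comp measurable_fst).mul (Measurable.ite
      ((measurableSet_le (by fun_prop) measurable_const).inter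
        (measurableSet_lt (by fun_prop) (by fun_prop))) measurable_const measurable_const)
  calc ∫⁻ ω, g ω * (if T n ω ≤ t ∧ t < T (n + 1) ω then 1 else 0) ∂μ
      = ∫⁻ ω, g ω * (if T n ω ≤ t ∧ t - T n ω < T (n + 1) ω - T n ω then 1 else 0) ∂μ := by
        refine lintegral_congr fun ω => congrArg _ (if_congr ?_ rfl rfl)
        exact and_congr_right fun hT => (tsub_lt_tsub_iff_right hT).symm
    _ = ∫⁻ ω, ∫⁻ q, g ω * (if T n ω ≤ t ∧ t - T n ω < q.2 then 1 else 0)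
          ∂jumpMeasure rate Q (ζ n ω).1 ∂μ :=
        h.lintegral_jump hrate n (hg.prodMk (measurable_history_time le_rfl _)) hm
    _ = _ := by
        refine lintegral_congr_ae ?_
        filter_upwards [h.jumpMeasure_Ioi_ae hrate n] with ω hω
        by_cases hT : T n ω ≤ t
        · have hind (q : E × ℝ≥0) : g ω * (if T n ω ≤ t ∧ t - T n ω < q.2 then 1 else 0) =
              (Prod.snd ⁻¹' Set.Ioi (t - T n ω)).indicator (fun _ => g ω) q := by
            by_cases hq : t - T n ω < q.2 <;> simp [hT, hq]
          simp_rw [hind]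
          rw [lintegral_indicator_const (measurable_snd measurableSet_Ioi), hω, if_pos hT]
        · simp [hT]

variable [IsMarkovKernel law]

theorem lintegral_jumpCountPath (hrate : Measurable rate)
    (h : IsSwitchingConstruction law rate Q x₀ μ X ζ Y T) (n k : ℕ) (t : ℝ≥0) {g : Ω → ℝ≥0∞}
    (hg : Measurable[history ζ Y T n n] g) {f : E → ℝ≥0∞} (hf : Measurable f) :
    ∫⁻ ω, g ω * (if T n ω ≤ t then
        ∫⁻ y, f y ∂jumpCountPath law hrate Q k (ζ n ω, t - T n ω) else 0) ∂μ =
      ∫⁻ ω, g ω * (if T n ω ≤ t then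
        ∫⁻ y, f y ∂jumpCount law hrate Q k (Y n ω, t - T n ω) else 0) ∂μ := by
  have hm : Measurable fun p : ℝ≥0 × CadlagPath E =>
      if p.1 ≤ t then ∫⁻ y, f y ∂jumpCountPath law hrate Q k (p.2, t - p.1) else 0 :=
    Measurable.ite (measurableSet_le measurable_fst measurable_const)
      (hf.lintegral_kernel.comp (by fun_prop)) measurable_const
  rw [h.lintegral_path n (W := fun ω => (g ω, T n ω))
    (Φ := fun p => p.1.1 * if p.1.2 ≤ t then
      ∫⁻ y, f y ∂jumpCountPath law hrate Q k (p.2, t - p.1.2) else 0)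
    (hg.prodMk (measurable_history_time le_rfl n))
    ((measurable_fst.comp measurable_fst).mul
      (hm.comp ((measurable_snd.comp measurable_fst).prodMk measurable_snd)))]
  refine lintegral_congr fun ω => ?_
  refine (lintegral_const_mul _ (hm.comp measurable_prodMk_left)).trans (congrArg _ ?_)
  simp only [Function.comp_apply]
  split_ifs
  · exact (lintegral_jumpCount law hrate Q k _ _ hf).symm
  · exact lintegral_zero

/-- The induction hypothesis at `n + 1` handles the jumps after `T (n + 1)`. Integrating out the
next jump, then the path `ζ n`, reproduces the recursion of `jumpCount`. -/
theorem lintegral_between_jumps (hrate : Measurable rate)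
    (h : IsSwitchingConstruction law rate Q x₀ μ X ζ Y T) (k n : ℕ) (t : ℝ≥0) {g : Ω → ℝ≥0∞}
    (hg : Measurable[history ζ Y T n n] g) {f : E → ℝ≥0∞} (hf : Measurable f) :
    ∫⁻ ω, g ω * (if T (n + k) ω ≤ t ∧ t < T (n + k + 1) ω then f (X t ω) else 0) ∂μ =
      ∫⁻ ω, g ω * (if T n ω ≤ t then
        ∫⁻ y, f y ∂jumpCount law hrate Q k (Y n ω, t - T n ω) else 0) ∂μ := by
  induction k generalizing n g with
  | zero =>
    have hm : Measurable fun p : ℝ≥0∞ × ℝ≥0 × CadlagPath E => p.1 * f (p.2.2.1 (t - p.2.1)) :=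
      measurable_fst.mul (hf.comp (measurable_eval_comp (by fun_prop) (by fun_prop)))
    have hg' : Measurable[history ζ Y T (n + 1) n] fun ω => g ω * f ((ζ n ω).1 (t - T n ω)) :=
      hm.comp ((hg.mono (history_mono n.le_succ le_rfl) le_rfl).prodMk
        ((measurable_history_time le_rfl _).prodMk (measurable_history_path n.lt_succ_self _)))
    rw [← h.lintegral_jumpCountPath hrate n 0 t hg hf]
    calc ∫⁻ ω, g ω * (if T (n + 0) ω ≤ t ∧ t < T (n + 0 + 1) ω then f (X t ω) else 0) ∂μ
        = ∫⁻ ω, g ω * f ((ζ n ω).1 (t - T n ω)) *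
            (if T n ω ≤ t ∧ t < T (n + 1) ω then 1 else 0) ∂μ := by
          refine lintegral_congr_ae ?_
          filter_upwards [h.process_eq] with ω hω
          simp only [add_zero]
          split_ifs with hT
          · rw [hω n t hT.1 hT.2, mul_one]
          · rw [mul_zero, mul_zero]
      _ = ∫⁻ ω, g ω * f ((ζ n ω).1 (t - T n ω)) *
            (if T n ω ≤ t then survival rate (ζ n ω).1 (t - T n ω) else 0) ∂μ :=
          h.lintegral_no_jump hrate n t hg'
      _ = _ := by
          refine lintegral_congr fun ω => ?_
          rw [lintegral_jumpCountPath_zero law hrate Q _ _ hf]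
          split_ifs
          · ring
          · rw [mul_zero, mul_zero]
  | succ k ih =>
    have hm : Measurable fun p : (ℝ≥0∞ × ℝ≥0) × E × ℝ≥0 =>
        p.1.1 * (if p.1.2 + p.2.2 ≤ t then
          ∫⁻ y, f y ∂jumpCount law hrate Q k (p.2.1, t - (p.1.2 + p.2.2)) else 0) :=
      (measurable_fst.comp measurable_fst).mul (Measurable.ite
        (measurableSet_le (by fun_prop) measurable_const)
        (hf.lintegral_kernel.comp (by fun_prop)) measurable_const)
    have hg' : Measurable[history ζ Y T (n + 1) n] g :=
      hg.mono (history_mono n.le_succ le_rfl) le_rfl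
    rw [← h.lintegral_jumpCountPath hrate n (k + 1) t hg hf]
    calc ∫⁻ ω, g ω *
          (if T (n + (k + 1)) ω ≤ t ∧ t < T (n + (k + 1) + 1) ω then f (X t ω) else 0) ∂μ
        = ∫⁻ ω, g ω * (if T (n + 1) ω ≤ t then
            ∫⁻ y, f y ∂jumpCount law hrate Q k (Y (n + 1) ω, t - T (n + 1) ω) else 0) ∂μ := by
          rw [← ih (n + 1) (hg.mono (history_mono n.le_succ n.le_succ) le_rfl),
            show n + (k + 1) = n + 1 + k by omega]
      _ = ∫⁻ ω, g ω * (if T n ω + (T (n + 1) ω - T n ω) ≤ t then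
            ∫⁻ y, f y ∂jumpCount law hrate Q k
              (Y (n + 1) ω, t - (T n ω + (T (n + 1) ω - T n ω))) else 0) ∂μ := by
          simp_rw [fun ω => add_tsub_cancel_of_le (h.time_le n ω)]
      _ = ∫⁻ ω, ∫⁻ q, g ω * (if T n ω + q.2 ≤ t then
            ∫⁻ y, f y ∂jumpCount law hrate Q k (q.1, t - (T n ω + q.2)) else 0)
              ∂jumpMeasure rate Q (ζ n ω).1 ∂μ :=
          h.lintegral_jump hrate n (hg'.prodMk (measurable_history_time le_rfl _)) hm
      _ = _ := by
          refine lintegral_congr fun ω => ?_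
          by_cases hT : T n ω ≤ t
          · have hind (q : E × ℝ≥0) : (if T n ω + q.2 ≤ t then
                ∫⁻ y, f y ∂jumpCount law hrate Q k (q.1, t - (T n ω + q.2)) else 0) =
                (Prod.snd ⁻¹' Set.Iic (t - T n ω)).indicator (fun q : E × ℝ≥0 =>
                  ∫⁻ y, f y ∂jumpCount law hrate Q k (q.1, t - T n ω - q.2)) q := by
              rw [tsub_add_eq_tsub_tsub]
              exact ite_eq_indicator (S := Prod.snd ⁻¹' Set.Iic (t - T n ω))
                (fun q : E × ℝ≥0 => ∫⁻ y, f y ∂jumpCount law hrate Q k (q.1, t - T n ω - q.2))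
                (le_tsub_iff_left hT).symm
            have hm' : Measurable fun q : E × ℝ≥0 =>
                ∫⁻ y, f y ∂jumpCount law hrate Q k (q.1, t - T n ω - q.2) :=
              hf.lintegral_kernel.comp (by fun_prop)
            simp_rw [hind]
            rw [lintegral_const_mul _ (hm'.indicator (measurable_snd measurableSet_Iic)),
              if_pos hT, lintegral_jumpCountPath_succ law hrate Q _ _ _ hf,
              lintegral_indicator (measurable_snd measurableSet_Iic)]
          · have (q : E × ℝ≥0) : ¬ T n ω + q.2 ≤ t := fun hq => hT (le_self_add.trans hq)
            simp [hT, this]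

/-- The switching process restarts afresh at the jump time `T n`. -/
theorem lintegral_restart (hrate : Measurable rate)
    (h : IsSwitchingConstruction law rate Q x₀ μ X ζ Y T) (n : ℕ) (t : ℝ≥0) {g : Ω → ℝ≥0∞}
    (hg : Measurable[history ζ Y T n n] g) {f : E → ℝ≥0∞} (hf : Measurable f) :
    ∫⁻ ω, g ω * (if T n ω ≤ t then f (X t ω) else 0) ∂μ =
      ∫⁻ ω, g ω * (if T n ω ≤ t then
        ∫⁻ y, f y ∂minimalKernel law hrate Q (Y n ω, t - T n ω) else 0) ∂μ := by
  have hgm : Measurable g := hg.mono (h.history_le n n) le_rfl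
  have hTm := h.measurable_time
  have hYm := h.measurable_position
  have hXm := h.measurable_process
  calc ∫⁻ ω, g ω * (if T n ω ≤ t then f (X t ω) else 0) ∂μ
      = ∫⁻ ω, ∑' k, g ω *
          (if T (n + k) ω ≤ t ∧ t < T (n + k + 1) ω then f (X t ω) else 0) ∂μ := by
        refine lintegral_congr_ae ?_
        filter_upwards [h.tsum_between_jumps] with ω hω
        rw [ENNReal.tsum_mul_left, hω]
    _ = ∑' k, ∫⁻ ω, g ω *
          (if T (n + k) ω ≤ t ∧ t < T (n + k + 1) ω then f (X t ω) else 0) ∂μ := by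
        refine lintegral_tsum fun k => (hgm.mul (Measurable.ite
          ((measurableSet_le (hTm _) measurable_const).inter
            (measurableSet_lt measurable_const (hTm _)))
          (hf.comp (hXm t)) measurable_const)).aemeasurable
    _ = ∑' k, ∫⁻ ω, g ω * (if T n ω ≤ t then
          ∫⁻ y, f y ∂jumpCount law hrate Q k (Y n ω, t - T n ω) else 0) ∂μ :=
        tsum_congr fun k => h.lintegral_between_jumps hrate k n t hg hf
    _ = ∫⁻ ω, ∑' k, g ω * (if T n ω ≤ t then
          ∫⁻ y, f y ∂jumpCount law hrate Q k (Y n ω, t - T n ω) else 0) ∂μ := by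
        refine (lintegral_tsum fun k => (hgm.mul (Measurable.ite
          (measurableSet_le (hTm _) measurable_const)
          (hf.lintegral_kernel.comp ((hYm n).prodMk (measurable_const.sub (hTm n))))
            measurable_const)).aemeasurable).symm
    _ = _ := by
        refine lintegral_congr fun ω => ?_
        rw [ENNReal.tsum_mul_left]
        split_ifs
        · rw [lintegral_minimalKernel]
        · rw [tsum_zero]

theorem lintegral_process (hrate : Measurable rate)
    (h : IsSwitchingConstruction law rate Q x₀ μ X ζ Y T) (t : ℝ≥0) {f : E → ℝ≥0∞}
    (hf : Measurable f) :
    ∫⁻ ω, f (X t ω) ∂μ = ∫⁻ y, f y ∂minimalKernel law hrate Q (x₀, t) := by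
  have := h.lintegral_restart hrate 0 t (g := fun _ => 1) measurable_const hf
  simpa [h.time_zero, h.position_zero] using this

end IsSwitchingConstruction

end Markov


/-! ### The Markov property at a fixed time -/

section Markov

variable {E : Type*} [TopologicalSpace E] [MeasurableSpace E] [BorelSpace E]
  [TopologicalSpace.PseudoMetrizableSpace E] {Ω : Type*}
  {ζ : ℕ → Ω → CadlagPath E} {Y : ℕ → Ω → E} {T : ℕ → Ω → ℝ≥0}
  {mΩ : MeasurableSpace Ω} {law : Kernel E (CadlagPath E)} {rate : E → ℝ≥0}
  {Q : Kernel E E} {x₀ : E} {μ : Measure Ω} {X : ℝ≥0 → Ω → E}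

namespace IsSwitchingConstruction

variable [IsProbabilityMeasure μ] [IsMarkovKernel Q]

/-- Between `T n` and `T (n + 1)`, the future is decided by the current path and its jump
mechanism, both shifted to the present. -/
theorem lintegral_future [IsMarkovKernel law] (hrate : Measurable rate)
    (h : IsSwitchingConstruction law rate Q x₀ μ X ζ Y T) (n : ℕ) (s t : ℝ≥0) {g : Ω → ℝ≥0∞}
    (hg : Measurable[history ζ Y T (n + 1) n] g) {f : E → ℝ≥0∞} (hf : Measurable f) :
    ∫⁻ ω, g ω * (if T n ω ≤ s ∧ s < T (n + 1) ω then f (X (s + t) ω) else 0) ∂μ =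
      ∫⁻ ω, g ω * (if T n ω ≤ s then survival rate (ζ n ω).1 (s - T n ω) *
        ∫⁻ y, f y ∂minimalKernelPath law hrate Q (shift (s - T n ω) (ζ n ω), t) else 0) ∂μ := by
  have hW : Measurable[history ζ Y T (n + 1) n] fun ω => (g ω, T n ω, ζ n ω) :=
    hg.prodMk ((measurable_history_time le_rfl _).prodMk (measurable_history_path n.lt_succ_self _))
  have hgm : Measurable g := hg.mono (h.history_le _ _) le_rfl
  have hTm := h.measurable_time
  have hXm := h.measurable_process
  -- no jump in `(s, s + t]`
  have hm1 : Measurable fun p : ℝ≥0∞ × ℝ≥0 × CadlagPath E =>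
      p.1 * (if p.2.1 ≤ s then f (p.2.2.1 (s + t - p.2.1)) else 0) :=
    measurable_fst.mul (Measurable.ite (measurableSet_le (by fun_prop) measurable_const)
      (hf.comp (measurable_eval_comp (by fun_prop) (by fun_prop))) measurable_const)
  have h1 := h.lintegral_no_jump hrate n (s + t) (hm1.comp hW)
  -- a first jump in `(s, s + t]`
  have hm2 : Measurable fun p : ℝ≥0∞ × ℝ≥0 × ℝ≥0 =>
      p.1 * (if p.2.1 ≤ s ∧ s < p.2.2 then 1 else 0) :=
    measurable_fst.mul (Measurable.ite ((measurableSet_le (by fun_prop) measurable_const).inter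
      (measurableSet_lt measurable_const (by fun_prop))) measurable_const measurable_const)
  have hW2 : Measurable[history ζ Y T (n + 1) (n + 1)] fun ω => (g ω, T n ω, T (n + 1) ω) :=
    (hg.mono (history_mono le_rfl n.le_succ) le_rfl).prodMk
      ((measurable_history_time n.le_succ _).prodMk (measurable_history_time le_rfl _))
  have h2 := h.lintegral_restart hrate (n + 1) (s + t) (hm2.comp hW2) hf
  have hm3 : Measurable fun p : (ℝ≥0∞ × ℝ≥0) × E × ℝ≥0 =>
      p.1.1 * (if p.1.2 ≤ s ∧ s - p.1.2 < p.2.2 ∧ p.2.2 ≤ s - p.1.2 + t then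
        ∫⁻ y, f y ∂minimalKernel law hrate Q (p.2.1, s - p.1.2 + t - p.2.2) else 0) :=
    (measurable_fst.comp measurable_fst).mul (Measurable.ite
      ((measurableSet_le (by fun_prop) measurable_const).inter
        ((measurableSet_lt (by fun_prop) (by fun_prop)).inter
          (measurableSet_le (by fun_prop) (by fun_prop))))
      (hf.lintegral_kernel.comp (by fun_prop)) measurable_const)
  have h3 := h.lintegral_jump hrate n
    (hg.prodMk (measurable_history_time (ζ := ζ) (Y := Y) (T := T) le_rfl (n + 1))) hm3
  simp only [Function.comp_apply] at h1 h2
  calc ∫⁻ ω, g ω * (if T n ω ≤ s ∧ s < T (n + 1) ω then f (X (s + t) ω) else 0) ∂μ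
      = ∫⁻ ω, g ω * (if T n ω ≤ s then f ((ζ n ω).1 (s + t - T n ω)) else 0) *
            (if T n ω ≤ s + t ∧ s + t < T (n + 1) ω then 1 else 0) +
          g ω * (if T n ω ≤ s ∧ s < T (n + 1) ω then 1 else 0) *
            (if T (n + 1) ω ≤ s + t then f (X (s + t) ω) else 0) ∂μ := by
        refine lintegral_congr_ae ?_
        filter_upwards [h.process_eq] with ω hω
        by_cases hT : T n ω ≤ s
        · have hT' : T n ω ≤ s + t := hT.trans le_self_add
          by_cases hst : s + t < T (n + 1) ω
          · have hs : s < T (n + 1) ω := le_self_add.trans_lt hst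
            simp [hT, hT', hst, hs, hst.not_ge, hω n (s + t) hT' hst]
          · simp [hT, hst, not_lt.1 hst]
        · simp [hT]
    _ = ∫⁻ ω, g ω * (if T n ω ≤ s then f ((ζ n ω).1 (s + t - T n ω)) else 0) *
            (if T n ω ≤ s + t then survival rate (ζ n ω).1 (s + t - T n ω) else 0) ∂μ +
          ∫⁻ ω, ∫⁻ q, g ω * (if T n ω ≤ s ∧ s - T n ω < q.2 ∧ q.2 ≤ s - T n ω + t then
            ∫⁻ y, f y ∂minimalKernel law hrate Q (q.1, s - T n ω + t - q.2) else 0)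
              ∂jumpMeasure rate Q (ζ n ω).1 ∂μ := by
        rw [lintegral_add_right, h1, h2, ← h3]
        · congr 1
          refine lintegral_congr fun ω => ?_
          by_cases hT : T n ω ≤ s
          · have hle := h.time_le n ω
            have e1 : s - T n ω < T (n + 1) ω - T n ω ↔ s < T (n + 1) ω :=
              tsub_lt_tsub_iff_right hT
            have e2 : T (n + 1) ω - T n ω ≤ s - T n ω + t ↔ T (n + 1) ω ≤ s + t := by
              rw [tsub_add_eq_add_tsub hT, tsub_le_tsub_iff_right (hT.trans le_self_add)]
            have e3 : s - T n ω + t - (T (n + 1) ω - T n ω) = s + t - T (n + 1) ω := by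
              rw [tsub_add_eq_add_tsub hT, tsub_tsub_tsub_cancel_right hle]
            simp only [hT, true_and, e1, e2, e3]
            by_cases hs : s < T (n + 1) ω <;> simp [hs]
          · simp [hT]
        · exact (hm2.comp (hgm.prodMk ((hTm n).prodMk (hTm (n + 1))))).mul (Measurable.ite
            (measurableSet_le (hTm _) measurable_const) (hf.comp (hXm _)) measurable_const)
    _ = _ := by
        rw [← lintegral_add_left]
        · refine lintegral_congr fun ω => ?_
          by_cases hT : T n ω ≤ s
          · set r := s - T n ω with hr
            have hrt : s + t - T n ω = r + t := (tsub_add_eq_add_tsub hT).symm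
            have hF : Measurable fun q : E × ℝ≥0 => ∫⁻ y, f y ∂minimalKernel law hrate Q q :=
              hf.lintegral_kernel
            have hind (q : E × ℝ≥0) : (if T n ω ≤ s ∧ r < q.2 ∧ q.2 ≤ r + t then
                ∫⁻ y, f y ∂minimalKernel law hrate Q (q.1, r + t - q.2) else 0) =
                (Prod.snd ⁻¹' Set.Ioc r (r + t)).indicator (fun q : E × ℝ≥0 =>
                  ∫⁻ y, f y ∂minimalKernel law hrate Q (q.1, r + t - q.2)) q := by
              exact ite_eq_indicator (S := Prod.snd ⁻¹' Set.Ioc r (r + t))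
                (fun q : E × ℝ≥0 => ∫⁻ y, f y ∂minimalKernel law hrate Q (q.1, r + t - q.2))
                (and_iff_right hT)
            have hF' : Measurable fun q : E × ℝ≥0 =>
                ∫⁻ y, f y ∂minimalKernel law hrate Q (q.1, r + t - q.2) :=
              hF.comp (by fun_prop)
            simp_rw [hind]
            -- Both terms contain the factor `survival` at `r`; what remains is the renewal equation
            -- for the path shifted by `r`.
            rw [lintegral_const_mul _ (hF'.indicator (measurable_snd measurableSet_Ioc)),
              lintegral_indicator (measurable_snd measurableSet_Ioc),
              setLIntegral_jumpMeasure_Ioc Q hrate (Switching.measurable_path _) hF, if_pos hT, if_pos hT,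
              if_pos (hT.trans le_self_add), hrt, lintegral_minimalKernelPath_eq law hrate Q _ _ hf,
              survival_add]
            simp only [shift]
            ring
          · simp [hT]
        · exact (hm1.comp (hgm.prodMk ((hTm n).prodMk (h.measurable_path n)))).mul (Measurable.ite
            (measurableSet_le (hTm _) measurable_const) (measurable_survival_comp hrate
              (h.measurable_path n) (measurable_const.sub (hTm n))) measurable_const)

/-- Markov property at time `s`, between the jump times `T n` and `T (n + 1)`. -/
theorem setLIntegral_between_jumps (hlaw : IsMarkovFamily law) (hrate : Measurable rate)
    (h : IsSwitchingConstruction law rate Q x₀ μ X ζ Y T) (n : ℕ) (s t : ℝ≥0) {A : Set Ω}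
    (hA : MeasurableSet[past X s] A) {f : E → ℝ≥0∞} (hf : Measurable f) :
    ∫⁻ ω in A, (if T n ω ≤ s ∧ s < T (n + 1) ω then f (X (s + t) ω) else 0) ∂μ =
      ∫⁻ ω in A, (if T n ω ≤ s ∧ s < T (n + 1) ω then
        ∫⁻ y, f y ∂minimalKernel law hrate Q (X s ω, t) else 0) ∂μ := by
  have := hlaw.isMarkovKernel
  obtain ⟨D, hD, hAD⟩ := h.exists_set_of_past n hA
  have hAm : MeasurableSet A := past_le h.measurable_process s A hA
  let g : Ω → ℝ≥0∞ := fun ω =>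
    D.indicator 1 (record x₀ ζ T n ω, stopAt (s - T n ω) (ζ n ω))
  have hDm : Measurable (D.indicator
      (1 : ((ℕ → CadlagPath E) × (ℕ → ℝ≥0)) × CadlagPath E → ℝ≥0∞)) := measurable_one.indicator hD
  have hst : Measurable fun p : ℝ≥0 × CadlagPath E => stopAt (s - p.1) p.2 :=
    measurable_stop_comp (by fun_prop) (by fun_prop)
  have hg : Measurable[history ζ Y T (n + 1) n] g :=
    hDm.comp (((measurable_record (ζ := ζ) (Y := Y) (T := T) x₀ n).mono
      (history_mono n.le_succ le_rfl) le_rfl).prodMk (hst.comp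
        ((measurable_history_time (ζ := ζ) (Y := Y) (T := T) le_rfl _).prodMk
          (measurable_history_path n.lt_succ_self _))))
  have hset (v : Ω → ℝ≥0∞) :
      ∫⁻ ω in A, (if T n ω ≤ s ∧ s < T (n + 1) ω then v ω else 0) ∂μ =
        ∫⁻ ω, g ω * (if T n ω ≤ s ∧ s < T (n + 1) ω then v ω else 0) ∂μ := by
    rw [← lintegral_indicator hAm]
    refine lintegral_congr_ae ?_
    filter_upwards [hAD] with ω hω
    by_cases hT : T n ω ≤ s ∧ s < T (n + 1) ω
    · have hmem := hω hT.1 hT.2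
      by_cases hωA : ω ∈ A
      · simp [g, hωA, hmem.1 hωA]
      · simp [g, hωA, mt hmem.2 hωA]
    · rw [if_neg hT, mul_zero, Set.indicator_apply_eq_zero]
      exact fun _ => if_neg hT
  have hF : Measurable fun x => ∫⁻ y, f y ∂minimalKernel law hrate Q (x, t) :=
    hf.lintegral_kernel.comp (by fun_prop)
  -- The right-hand side is a function of `X s`, hence the same formula with no time ahead and test
  -- function `F`; both sides can then be compared after conditioning.
  have hFpath := h.lintegral_future hrate n s 0 hg hF
  rw [hset, hset, h.lintegral_future hrate n s t hg hf]
  simp only [add_zero] at hFpath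
  rw [hFpath]
  -- condition on the record and apply the Markov property of the current path
  have hW : Measurable[history ζ Y T n n] fun ω => (record x₀ ζ T n ω, T n ω) :=
    (measurable_record x₀ n).prodMk (measurable_history_time le_rfl _)
  have hpath (u : ℝ≥0) {k : E → ℝ≥0∞} (hk : Measurable k) :
      ∫⁻ ω, g ω * (if T n ω ≤ s then survival rate (ζ n ω).1 (s - T n ω) *
        ∫⁻ y, k y ∂minimalKernelPath law hrate Q (shift (s - T n ω) (ζ n ω), u) else 0) ∂μ =
      ∫⁻ ω, (if T n ω ≤ s then ∫⁻ z, D.indicator 1 (record x₀ ζ T n ω, stopAt (s - T n ω) z) *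
        survival rate (stopAt (s - T n ω) z).1 (s - T n ω) *
          ∫⁻ y, k y ∂minimalKernel law hrate Q (z.1 (s - T n ω), u) ∂law (Y n ω) else 0) ∂μ := by
    have hΦ : Measurable fun p : (((ℕ → CadlagPath E) × (ℕ → ℝ≥0)) × ℝ≥0) × CadlagPath E =>
        D.indicator 1 (p.1.1, stopAt (s - p.1.2) p.2) * (if p.1.2 ≤ s then
          survival rate p.2.1 (s - p.1.2) *
            ∫⁻ y, k y ∂minimalKernelPath law hrate Q (shift (s - p.1.2) p.2, u) else 0) :=
      (hDm.comp (by fun_prop)).mul (Measurable.ite (measurableSet_le (by fun_prop)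
        measurable_const) ((measurable_survival_comp hrate (by fun_prop) (by fun_prop)).mul
          (hk.lintegral_kernel.comp (by fun_prop))) measurable_const)
    refine (h.lintegral_path n hW hΦ).trans (lintegral_congr fun ω => ?_)
    split_ifs with hT
    · rw [← hlaw.lintegral_stop_mul_minimalKernelPath hrate Q (Y n ω) (s - T n ω) u
        (h := fun z => D.indicator 1 (record x₀ ζ T n ω, z) * survival rate z.1 (s - T n ω))
        ((hDm.comp (by fun_prop)).mul
          (measurable_survival_comp hrate measurable_id measurable_const)) hk]
      refine lintegral_congr fun z => ?_
      simp only [survival_stop, mul_assoc]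
    · simp
  rw [hpath t hf, hpath 0 hF]
  refine lintegral_congr fun ω => ?_
  split_ifs
  · refine lintegral_congr fun z => ?_
    -- With no time remaining the kernel is a Dirac mass, so `F` is evaluated at the present
    -- position, which is the integral for remaining time `t`.
    rw [hlaw.minimalKernel_zero hrate Q, lintegral_dirac' _ hF]
  · rfl

/-- The law of `X n` is the minimal kernel from `x₀`, which therefore has full mass. -/
theorem mem_nonexplosive [IsMarkovKernel law] (hrate : Measurable rate)
    (h : IsSwitchingConstruction law rate Q x₀ μ X ζ Y T) : x₀ ∈ nonexplosive law hrate Q := by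
  intro n
  have := h.lintegral_process hrate n (f := fun _ => 1) measurable_const
  simpa using this.symm

theorem ae_mem_nonexplosive (hlaw : IsMarkovFamily law) (hrate : Measurable rate)
    (h : IsSwitchingConstruction law rate Q x₀ μ X ζ Y T) (s : ℝ≥0) :
    ∀ᵐ ω ∂μ, X s ω ∈ nonexplosive law hrate Q := by
  have := hlaw.isMarkovKernel
  have hm := measurableSet_nonexplosive law hrate Q
  have hf : Measurable ((nonexplosive law hrate Q)ᶜ.indicator (1 : E → ℝ≥0∞)) :=
    measurable_one.indicator hm.compl
  have h0 := hlaw.ae_mem_nonexplosive hrate Q (h.mem_nonexplosive hrate) s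
  have h0' : minimalKernel law hrate Q (x₀, s) (nonexplosive law hrate Q)ᶜ = 0 := h0
  have h1 := h.lintegral_process hrate s hf
  rw [lintegral_indicator_one hm.compl, h0'] at h1
  have h2 := (lintegral_eq_zero_iff (hf.comp (h.measurable_process s))).1 h1
  filter_upwards [h2] with ω hω
  by_contra hc
  simp [hc] at hω

/-- Sum the identity between successive jumps over all `n`. Since `X s` is almost surely
nonexplosive, freezing the other states changes nothing. -/
theorem isMarkov_transition (hlaw : IsMarkovFamily law) (hrate : Measurable rate)
    (h : IsSwitchingConstruction law rate Q x₀ μ X ζ Y T) :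
    IsMarkovProcess (transition law hrate Q) μ X where
  measurable := h.measurable_process
  condLaw s t := by
    have := hlaw.isMarkovKernel
    refine ⟨fun B hB => ((transition law hrate Q t).measurable_coe hB).comp
      (measurable_past le_rfl), fun A hA B hB => ?_⟩
    have hXm := h.measurable_process
    have hTm := h.measurable_time
    have hf : Measurable (B.indicator (1 : E → ℝ≥0∞)) := measurable_one.indicator hB
    have hF : Measurable fun x => ∫⁻ y, B.indicator 1 y ∂minimalKernel law hrate Q (x, t) :=
      hf.lintegral_kernel.comp (by fun_prop)
    have hAm : MeasurableSet A := past_le hXm s A hA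
    have hsum {v : Ω → ℝ≥0∞} (hv : Measurable v) : ∫⁻ ω in A, v ω ∂μ =
        ∑' n, ∫⁻ ω in A, (if T n ω ≤ s ∧ s < T (n + 1) ω then v ω else 0) ∂μ := by
      refine Eq.trans ?_ (lintegral_tsum fun n => (Measurable.ite ((measurableSet_le (hTm n)
        measurable_const).inter (measurableSet_lt measurable_const (hTm (n + 1)))) hv
          measurable_const).aemeasurable)
      refine lintegral_congr_ae (ae_restrict_of_ae ?_)
      filter_upwards [h.tsum_between_jumps] with ω hω
      have := hω 0 s (v ω)
      simp only [zero_add, h.time_zero, zero_le, if_true] at this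
      exact this.symm
    calc μ (A ∩ X (s + t) ⁻¹' B)
        = ∫⁻ ω in A, B.indicator 1 (X (s + t) ω) ∂μ := by
          have hB' := hXm (s + t) hB
          rw [Set.inter_comm, ← Measure.restrict_apply hB', ← lintegral_indicator_one hB']
          rfl
      _ = ∫⁻ ω in A, ∫⁻ y, B.indicator 1 y ∂minimalKernel law hrate Q (X s ω, t) ∂μ := by
          refine (hsum (hf.comp (hXm _))).trans (Eq.trans ?_ (hsum (hF.comp (hXm s))).symm)
          exact tsum_congr fun n => h.setLIntegral_between_jumps hlaw hrate n s t hA hf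
      _ = ∫⁻ ω in A, transition law hrate Q t (X s ω) B ∂μ := by
          refine lintegral_congr_ae (ae_restrict_of_ae ?_)
          filter_upwards [h.ae_mem_nonexplosive hlaw hrate s] with ω hω
          rw [lintegral_indicator_one hB, transition_of_mem law hrate Q hω]

end IsSwitchingConstruction

end Markov

end Switching

end

/-- A switching process associated with a Markov process `ζ` and with `M` is a Markov process, with
a transition function that is the same for all initial states. -/
theorem mainTheorem5 {d : ℕ}
    (law : Kernel (EuclideanSpace ℝ (Fin d)) (Switching.CadlagPath (EuclideanSpace ℝ (Fin d))))
    (hlaw : Switching.IsMarkovFamily law)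
    (rate : EuclideanSpace ℝ (Fin d) → ℝ≥0) (hrate : Measurable rate)
    (Q : Kernel (EuclideanSpace ℝ (Fin d)) (EuclideanSpace ℝ (Fin d))) (hQ : IsMarkovKernel Q)
    (hlocal : ∀ x, ∀ᵐ ζ ∂(law x), ∃ ε : ℝ≥0, 0 < ε ∧ Switching.cumRate rate ζ.1 ε < ∞)
    (hinfty : ∀ x, ∀ᵐ ζ ∂(law x), ∫⁻ v : ℝ≥0, (rate (ζ.1 v) : ℝ≥0∞) ∂Switching.lebesgue = ∞) :
    ∃ P : ℝ≥0 → Kernel (EuclideanSpace ℝ (Fin d)) (EuclideanSpace ℝ (Fin d)),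
      Switching.IsTransitionFunction P ∧
      ∀ (x₀ : EuclideanSpace ℝ (Fin d)) (Ω : Type*) (_ : MeasurableSpace Ω) (μ : Measure Ω)
        (_ : IsProbabilityMeasure μ) (X : ℝ≥0 → Ω → EuclideanSpace ℝ (Fin d)),
        Switching.IsSwitchingProcess law rate Q x₀ μ X → Switching.IsMarkovProcess P μ X := by
  refine ⟨Switching.transition law hrate Q, hlaw.isTransitionFunction hrate Q, ?_⟩
  rintro x₀ Ω _ μ _ X ⟨ζ, Y, T, h⟩
  exact h.isMarkov_transition hlaw hrate
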